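/- Let $S^3\subset\mathbb{R}^4=\mathbb{C}^2$ be the unit sphere with its standard tight contact structure $\xi_0=TS^3\cap iTS^3$. For a contact form $\alpha$ on $S^3$ with $\ker\alpha=\xi_0$, the Reeb flow $\varphi_t$ of $\alpha$ is the flow of the vector field $R$ determined by $\alpha(R)=1$ and $\iota_R d\alpha=0$. A global surface of section for $\varphi_t$ is a smoothly embedded, compact, connected surface $S\subset S^3$ (possibly with boundary) such that (i) the boundary $\partial S$ consists of periodic orbits of $\varphi_t$; (ii) $R$ is transverse to the interior $\mathring S$ of $S$; (iii) for every $x\in S^3\setminus\partial S$ there are $t_+>0$ and $t_-<0$ with $\varphi_{t_+}(x)\in\mathring S$ and $\varphi_{t_-}(x)\in\mathring S$. It is called disk-like if $S$ is diffeomorphic to the closed disk. Theorem. There is a smooth contact form $\alpha$ on $S^3$ with $\ker\alpha=\xi_0$ whose Reeb flow admits no global surface of section with exactly one boundary component. In particular, this Reeb flow admits no disk-like global surface of section. -/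

import Mathlib

open Set Metric Manifold
open scoped ContDiff RealInnerProductSpace

/-- The unit three-sphere in `ℝ⁴ = ℂ²`, with coordinates `(x 0 + i x 1, x 2 + i x 3)`. It carries
Mathlib's smooth structure, modelled on `EuclideanSpace ℝ (Fin 3)`. -/
abbrev ThreeSphere : Type := sphere (0 : EuclideanSpace ℝ (Fin 4)) 1

/-- The tangent space of the three-sphere at `x`, as a subspace of `ℝ⁴`. -/
noncomputable def tangentPlane (x : ThreeSphere) : Submodule ℝ (EuclideanSpace ℝ (Fin 4)) :=
  (Submodule.span ℝ {(x : EuclideanSpace ℝ (Fin 4))})ᗮ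

/-- The standard complex structure on `ℝ⁴ = ℂ²` (multiplication by `i`). -/
noncomputable def mulI (x : EuclideanSpace ℝ (Fin 4)) : EuclideanSpace ℝ (Fin 4) :=
  !₂[-x 1, x 0, -x 3, x 2]

/-- The standard (tight) contact structure on the three-sphere, i.e. the plane field of complex
tangencies: at `x` it consists of the tangent vectors `v` in the kernel of
`x₀ dx₁ - x₁ dx₀ + x₂ dx₃ - x₃ dx₂`, which is the real inner product with `i x`. -/
def standardContactPlane (x : ThreeSphere) : Set (EuclideanSpace ℝ (Fin 4)) :=
  {v | v ∈ tangentPlane x ∧ ⟪mulI x, v⟫ = 0}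

/-- The smooth one-form `α` on `ℝ⁴` restricts to a contact form on the three-sphere: at each point
the restriction of `α` to the tangent space is nonzero, and `dα` is nondegenerate on its kernel
(equivalently, `α ∧ dα` is a volume form on the three-sphere). Every smooth one-form on the
three-sphere is the restriction of a smooth one-form on `ℝ⁴`, and the exterior derivative commutes
with the restriction. -/
structure IsContactFormOnSphere
    (α : EuclideanSpace ℝ (Fin 4) → EuclideanSpace ℝ (Fin 4) [⋀^Fin 1]→L[ℝ] ℝ) : Prop where
  smooth : ContDiff ℝ ∞ α
  ne_zero : ∀ x : ThreeSphere, ∃ v ∈ tangentPlane x, α x ![v] ≠ 0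
  nondegenerate : ∀ x : ThreeSphere, ∀ u ∈ tangentPlane x, α x ![u] = 0 → u ≠ 0 →
    ∃ v ∈ tangentPlane x, α x ![v] = 0 ∧ extDeriv α x ![u, v] ≠ 0

/-- `R` is the Reeb vector field on the three-sphere of (the restriction of) the one-form `α`:
it is tangent to the sphere, `α(R) = 1`, and `dα(R, v) = 0` for all tangent vectors `v`. -/
structure IsReebVectorField
    (α : EuclideanSpace ℝ (Fin 4) → EuclideanSpace ℝ (Fin 4) [⋀^Fin 1]→L[ℝ] ℝ)
    (R : ThreeSphere → EuclideanSpace ℝ (Fin 4)) : Prop where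
  tangent : ∀ x : ThreeSphere, R x ∈ tangentPlane x
  normalized : ∀ x : ThreeSphere, α x ![R x] = 1
  kernel : ∀ x : ThreeSphere, ∀ v ∈ tangentPlane x, extDeriv α x ![R x, v] = 0

/-- `φ` is the flow on the three-sphere generated by the vector field `R`. -/
def IsFlowOf (R : ThreeSphere → EuclideanSpace ℝ (Fin 4)) (φ : Flow ℝ ThreeSphere) : Prop :=
  ∀ (x : ThreeSphere) (t : ℝ),
    HasDerivAt (fun s : ℝ ↦ (φ s x : EuclideanSpace ℝ (Fin 4))) (R (φ t x)) t

/-- The embedded surface `S = f(M)` in the three-sphere, where `M` is a compact connected smooth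
surface, possibly with boundary, is a global surface of section for the flow `φ` of the vector
field `R`. -/
structure IsGlobalSurfaceOfSection
    (R : ThreeSphere → EuclideanSpace ℝ (Fin 4)) (φ : Flow ℝ ThreeSphere)
    (M : Type) [TopologicalSpace M] [ChartedSpace (EuclideanHalfSpace 2) M]
    [IsManifold (𝓡∂ 2) ∞ M] [CompactSpace M] [ConnectedSpace M] (f : M → ThreeSphere) : Prop where
  embedding : IsSmoothEmbedding (𝓡∂ 2) (𝓡 3) ∞ f
  /-- the boundary of the surface consists of periodic orbits -/
  boundary_periodic : ∀ p ∈ (𝓡∂ 2).boundary M,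
    (∃ T : ℝ, 0 < T ∧ φ T (f p) = f p) ∧ ∀ t : ℝ, φ t (f p) ∈ f '' (𝓡∂ 2).boundary M
  /-- the vector field is transverse to the interior of the surface -/
  transverse : ∀ p ∈ (𝓡∂ 2).interior M, ∀ v : TangentSpace (𝓡∂ 2) p,
    mfderiv (𝓡∂ 2) 𝓘(ℝ, EuclideanSpace ℝ (Fin 4))
      (fun q ↦ (f q : EuclideanSpace ℝ (Fin 4))) p v ≠ R (f p)
  /-- every orbit off the boundary hits the interior in forward time -/
  hits_forward : ∀ x ∉ f '' (𝓡∂ 2).boundary M, ∃ t > 0, φ t x ∈ f '' (𝓡∂ 2).interior M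
  /-- every orbit off the boundary hits the interior in backward time -/
  hits_backward : ∀ x ∉ f '' (𝓡∂ 2).boundary M, ∃ t < 0, φ t x ∈ f '' (𝓡∂ 2).interior M

/-- The surface `M` has exactly one boundary component. -/
def HasOneBoundaryComponent (M : Type) [TopologicalSpace M]
    [ChartedSpace (EuclideanHalfSpace 2) M] : Prop :=
  IsConnected ((𝓡∂ 2).boundary M)

/-- The surface `M` is a disk: there is a smooth bijection with everywhere invertible differential
(that is, a diffeomorphism) from the closed unit disk onto `M`. -/
def IsDiskLike (M : Type) [TopologicalSpace M] [ChartedSpace (EuclideanHalfSpace 2) M] : Prop :=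
  ∃ g : EuclideanSpace ℝ (Fin 2) → M,
    ContMDiffOn 𝓘(ℝ, EuclideanSpace ℝ (Fin 2)) (𝓡∂ 2) ∞ g (closedBall 0 1) ∧
    BijOn g (closedBall 0 1) univ ∧
    ∀ x ∈ closedBall (0 : EuclideanSpace ℝ (Fin 2)) 1, Function.Bijective
      (mfderivWithin 𝓘(ℝ, EuclideanSpace ℝ (Fin 2)) (𝓡∂ 2) g (closedBall 0 1) x)

open Filter Topology

/-!
Suppose `S` is a global surface of section. Recording for every point off `∂S` the times at which
its orbit hits `S` gives an infinite cyclic covering of `S³ ∖ ∂S`, whose deck group is generated by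
the passage to the next hitting time. A periodic orbit in `S³ ∖ ∂S` of period `T` lifts to the path
along which the hitting time drops by `T`. This lift is not closed, so the orbit is not contractible
in `S³ ∖ ∂S`, and hence every disk bounded by a periodic orbit meets `∂S`.

The form `g(m) λ`, where `λ` is the standard contact form and `m = |z₁|² - |z₂|²`, has a Reeb flow
that preserves `m` and rotates `z₁` and `z₂` with speeds depending only on `m`. For `g = 1 + 3 m²`
the speed of `z₁` vanishes on `m = 1/3` and that of `z₂` on `m = -1/3`, so these levels are foliated
by periodic orbits that rotate only one coordinate. An orbit in the former bounds a disk in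
`m ≥ 1/3`, and one in the latter bounds a disk in `m ≤ -1/3`. A connected `∂S` is a single orbit and
therefore lies on a single level of `m`, so it cannot meet both disks.
-/

/-- A closed set `H` that meets every orbit of the flow `φ` in forward and in backward time, and
that is crossed by the orbits topologically: an orbit that starts close to a point of `H` meets `H`
exactly once within any small time. -/
structure IsGlobalCrossSection {X : Type*} [TopologicalSpace X] (φ : Flow ℝ X) (H : Set X) :
    Prop where
  isClosed : IsClosed H
  existsUnique_hit : ∀ x ∈ H, ∀ᶠ ε in 𝓝[>] (0 : ℝ), ∀ᶠ y in 𝓝 x, ∃! t, |t| < ε ∧ φ t y ∈ H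
  forward : ∀ x, ∃ t > 0, φ t x ∈ H
  backward : ∀ x, ∃ t < 0, φ t x ∈ H

namespace IsGlobalCrossSection

variable {X : Type*} [TopologicalSpace X] {φ : Flow ℝ X} {H : Set X}

/-- The space of pairs of a point and a time at which its orbit hits the cross section `H`. Its
projection to the first factor is the infinite cyclic covering determined by `H`. -/
abbrev HittingTimes (φ : Flow ℝ X) (H : Set X) : Type _ := {p : X × ℝ // φ p.2 p.1 ∈ H}

/-- The projection of the space of hitting times. -/
abbrev proj (φ : Flow ℝ X) (H : Set X) (z : HittingTimes φ H) : X := z.1.1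

lemma mem_of_proj_eq {z w : HittingTimes φ H} (hzw : proj φ H z = proj φ H w) :
    φ z.1.2 w.1.1 ∈ H :=
  (show z.1.1 = w.1.1 from hzw) ▸ z.2

lemma eventually_existsUnique_hit_near (h : IsGlobalCrossSection φ H) {x : X} {s : ℝ}
    (hs : φ s x ∈ H) :
    ∀ᶠ ε in 𝓝[>] (0 : ℝ), ∀ᶠ y in 𝓝 x, ∃! t, |t - s| < ε ∧ φ t y ∈ H := by
  have hφ : ContinuousAt (fun y ↦ φ s y) x := by fun_prop
  filter_upwards [h.existsUnique_hit _ hs] with ε hε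
  filter_upwards [hφ.eventually hε] with y ⟨t, ⟨ht, hty⟩, huniq⟩
  refine ⟨t + s, ⟨by simpa using ht, by rwa [Flow.map_add]⟩, fun t' ⟨ht', hty'⟩ ↦ ?_⟩
  rw [← huniq (t' - s) ⟨ht', by rwa [← Flow.map_add, sub_add_cancel]⟩, sub_add_cancel]

lemma isClosed_setOf_hit (h : IsGlobalCrossSection φ H) : IsClosed {p : X × ℝ | φ p.2 p.1 ∈ H} :=
  h.isClosed.preimage (by fun_prop : Continuous fun p : X × ℝ ↦ φ p.2 p.1)

lemma isClosed_hits (h : IsGlobalCrossSection φ H) (x : X) : IsClosed {t : ℝ | φ t x ∈ H} :=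
  h.isClosed.preimage (by fun_prop : Continuous fun t : ℝ ↦ φ t x)

lemma isDiscrete_hits (h : IsGlobalCrossSection φ H) (x : X) : IsDiscrete {t : ℝ | φ t x ∈ H} := by
  refine isDiscrete_iff_forall_mem_exists_isOpen.2 fun s hs ↦ ?_
  obtain ⟨ε, hε, hpos⟩ :=
    ((h.eventually_existsUnique_hit_near hs).and self_mem_nhdsWithin).exists
  refine ⟨ball s ε, isOpen_ball, Subset.antisymm (fun t ⟨ht, htx⟩ ↦ ?_) ?_⟩
  · exact hε.self_of_nhds.unique ⟨ht, htx⟩ ⟨by simpa using hpos, hs⟩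
  · exact singleton_subset_iff.2 ⟨mem_ball_self hpos, hs⟩

lemma finite_hits_inter_Icc (h : IsGlobalCrossSection φ H) (x : X) (a b : ℝ) :
    ({t : ℝ | φ t x ∈ H} ∩ Icc a b).Finite :=
  (isCompact_Icc.inter_left (h.isClosed_hits x)).finite
    ((h.isDiscrete_hits x).mono inter_subset_left)

lemma exists_isLeast_later_hit (h : IsGlobalCrossSection φ H) (x : X) (s : ℝ) :
    ∃ t, IsLeast {t : ℝ | φ t x ∈ H ∧ s < t} t := by
  obtain ⟨t, ht, htx⟩ := h.forward (φ s x)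
  rw [← Flow.map_add] at htx
  have hfin : ({t : ℝ | φ t x ∈ H} ∩ Ioc s (t + s)).Finite :=
    (h.finite_hits_inter_Icc x s (t + s)).subset (inter_subset_inter_right _ Ioc_subset_Icc_self)
  obtain ⟨u, ⟨hux, hu⟩, hmin⟩ := hfin.isCompact.exists_isLeast ⟨t + s, htx, by linarith, le_rfl⟩
  refine ⟨u, ⟨hux, hu.1⟩, fun v ⟨hvx, hv⟩ ↦ ?_⟩
  rcases le_total v (t + s) with hle | hle
  exacts [hmin ⟨hvx, hv, hle⟩, hu.2.trans hle]

lemma exists_isGreatest_earlier_hit (h : IsGlobalCrossSection φ H) (x : X) (s : ℝ) :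
    ∃ t, IsGreatest {t : ℝ | φ t x ∈ H ∧ t < s} t := by
  obtain ⟨t, ht, htx⟩ := h.backward (φ s x)
  rw [← Flow.map_add] at htx
  have hfin : ({t : ℝ | φ t x ∈ H} ∩ Ico (t + s) s).Finite :=
    (h.finite_hits_inter_Icc x (t + s) s).subset (inter_subset_inter_right _ Ico_subset_Icc_self)
  obtain ⟨u, ⟨hux, hu⟩, hmax⟩ := hfin.isCompact.exists_isGreatest ⟨t + s, htx, le_rfl, by linarith⟩
  refine ⟨u, ⟨hux, hu.2⟩, fun v ⟨hvx, hv⟩ ↦ ?_⟩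
  rcases le_total (t + s) v with hle | hle
  exacts [hmax ⟨hvx, hle, hv⟩, hle.trans hu.1]

/-- The deck transformation that moves each hitting time to the following one. -/
noncomputable def next (h : IsGlobalCrossSection φ H) (z : HittingTimes φ H) : HittingTimes φ H :=
  ⟨(z.1.1, (h.exists_isLeast_later_hit z.1.1 z.1.2).choose),
    (h.exists_isLeast_later_hit z.1.1 z.1.2).choose_spec.1.1⟩

@[simp] lemma proj_next (h : IsGlobalCrossSection φ H) (z : HittingTimes φ H) :
    proj φ H (h.next z) = proj φ H z := rfl

lemma isLeast_next (h : IsGlobalCrossSection φ H) (z : HittingTimes φ H) :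
    IsLeast {t : ℝ | φ t z.1.1 ∈ H ∧ z.1.2 < t} (h.next z).1.2 :=
  (h.exists_isLeast_later_hit z.1.1 z.1.2).choose_spec

lemma lt_next (h : IsGlobalCrossSection φ H) (z : HittingTimes φ H) : z.1.2 < (h.next z).1.2 :=
  (h.isLeast_next z).1.2

lemma next_le (h : IsGlobalCrossSection φ H) {z w : HittingTimes φ H}
    (hzw : proj φ H z = proj φ H w) (hlt : z.1.2 < w.1.2) : (h.next z).1.2 ≤ w.1.2 :=
  (h.isLeast_next z).2 ⟨mem_of_proj_eq hzw.symm, hlt⟩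

lemma bijective_next (h : IsGlobalCrossSection φ H) : Function.Bijective h.next := by
  refine ⟨fun z w hzw ↦ ?_, fun w ↦ ?_⟩
  · have hproj : proj φ H z = proj φ H w := (congrArg (proj φ H) hzw :)
    refine Subtype.ext (Prod.ext hproj (le_antisymm ?_ ?_)) <;> by_contra! hlt
    · exact (h.lt_next z).not_ge (hzw ▸ h.next_le hproj.symm hlt)
    · exact (h.lt_next w).not_ge (hzw ▸ h.next_le hproj hlt)
  · obtain ⟨s, ⟨hs, hsw⟩, hmax⟩ := h.exists_isGreatest_earlier_hit w.1.1 w.1.2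
    let z : HittingTimes φ H := ⟨(w.1.1, s), hs⟩
    refine ⟨z, Subtype.ext (Prod.ext rfl (le_antisymm (h.next_le rfl hsw) ?_))⟩
    by_contra! hlt
    exact (h.lt_next z).not_ge (hmax ⟨(h.next z).2, hlt⟩)

lemma continuous_proj : Continuous (proj φ H) := continuous_fst.comp continuous_subtype_val

lemma surjective_proj (h : IsGlobalCrossSection φ H) : Function.Surjective (proj φ H) := fun x ↦ by
  obtain ⟨t, -, ht⟩ := h.forward x
  exact ⟨⟨(x, t), ht⟩, rfl⟩

lemma isOpenMap_proj (h : IsGlobalCrossSection φ H) : IsOpenMap (proj φ H) := by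
  refine IsOpenMap.of_nhds_le fun z S hS ↦ ?_
  obtain ⟨N, hN, hNS⟩ := (mem_nhds_induced _ _ _).1 hS
  obtain ⟨U, hU, V, hV, hUV⟩ := mem_nhds_prod_iff.1 hN
  obtain ⟨δ, hδ, hδV⟩ := Metric.mem_nhds_iff.1 hV
  obtain ⟨ε, hε, hεδ⟩ := ((h.eventually_existsUnique_hit_near z.2).and
    (nhdsWithin_le_nhds (gt_mem_nhds hδ))).exists
  filter_upwards [hε, hU] with y ⟨t, ⟨ht, hty⟩, _⟩ hy
  exact hNS (a := ⟨(y, t), hty⟩) (hUV ⟨hy, hδV (ht.trans hεδ)⟩)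

lemma exists_injOn_proj (h : IsGlobalCrossSection φ H) (z : HittingTimes φ H) :
    ∃ U ∈ 𝓝 z, InjOn (proj φ H) U := by
  obtain ⟨ε, hε, hpos⟩ :=
    ((h.eventually_existsUnique_hit_near z.2).and self_mem_nhdsWithin).exists
  have htime : Continuous fun w : HittingTimes φ H ↦ w.1.2 := by fun_prop
  refine ⟨_, (continuous_proj.continuousAt.eventually hε).and
    (htime.continuousAt.eventually (ball_mem_nhds _ hpos)), fun w hw w' hw' hww' ↦ ?_⟩
  exact Subtype.ext (Prod.ext hww' (hw.1.unique ⟨hw.2, w.2⟩ ⟨hw'.2, mem_of_proj_eq hww'.symm⟩))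

lemma isLocalHomeomorph_proj (h : IsGlobalCrossSection φ H) : IsLocalHomeomorph (proj φ H) := by
  refine isLocalHomeomorph_iff_isOpenEmbedding_restrict.2 fun z ↦ ?_
  obtain ⟨U, hU, hinj⟩ := h.exists_injOn_proj z
  obtain ⟨V, hVU, hV, hz⟩ := mem_nhds_iff.1 hU
  exact ⟨V, hV.mem_nhds hz, .of_continuous_injective_isOpenMap
    (continuous_proj.comp continuous_subtype_val) (injOn_iff_injective.1 (hinj.mono hVU))
    (h.isOpenMap_proj.comp hV.isOpenMap_subtype_val)⟩

lemma continuous_next (h : IsGlobalCrossSection φ H) : Continuous h.next := by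
  refine continuous_iff_continuousAt.2 fun z ↦ ?_
  have hproj : Tendsto (proj φ H) (𝓝 z) (𝓝 z.1.1) := continuous_proj.tendsto z
  have htime : Tendsto (fun w : HittingTimes φ H ↦ w.1.2) (𝓝 z) (𝓝 z.1.2) :=
    (by fun_prop : Continuous fun w : HittingTimes φ H ↦ w.1.2).tendsto z
  refine IsInducing.subtypeVal.continuousAt_iff.2 (hproj.prodMk_nhds ?_)
  refine Metric.tendsto_nhds.2 fun δ hδ ↦ ?_
  have hgap : 0 < ((h.next z).1.2 - z.1.2) / 2 := half_pos (sub_pos.2 (h.lt_next z))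
  obtain ⟨ε, ⟨⟨hε, hε'⟩, hεδ, hεgap⟩, hpos : 0 < ε⟩ :=
    (((h.eventually_existsUnique_hit_near z.2).and
      (h.eventually_existsUnique_hit_near (h.next z).2)).and
      (nhdsWithin_le_nhds ((gt_mem_nhds hδ).and (gt_mem_nhds hgap)))
      |>.and self_mem_nhdsWithin).exists
  have hbetween : ∀ᶠ y in 𝓝 z.1.1, ∀ t ∈ Icc (z.1.2 + ε) ((h.next z).1.2 - ε), φ t y ∉ H := by
    refine isCompact_Icc.eventually_forall_of_forall_eventually fun t ht ↦ ?_
    refine h.isClosed_setOf_hit.isOpen_compl.mem_nhds fun hit ↦ ?_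
    linarith [ht.1, ht.2, (h.isLeast_next z).2 ⟨hit, by linarith [ht.1]⟩]
  filter_upwards [hproj.eventually hε, hproj.eventually hε', hproj.eventually hbetween,
    htime.eventually (ball_mem_nhds _ hpos)] with w huniq ⟨t, ⟨ht, htw⟩, _⟩ hbetween hw
  have hw' := abs_lt.1 (Real.dist_eq _ _ ▸ hw)
  have ht' := abs_lt.1 ht
  have hle : (h.next w).1.2 ≤ t := h.next_le (w := ⟨(w.1.1, t), htw⟩) rfl (by dsimp; linarith)
  have hlt := h.lt_next w
  have hlower : z.1.2 + ε ≤ (h.next w).1.2 := by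
    by_contra! hclose
    exact hlt.ne (huniq.unique ⟨hw, w.2⟩ ⟨abs_lt.2 ⟨by linarith, by linarith⟩, (h.next w).2⟩)
  have hlower' : (h.next z).1.2 - ε < (h.next w).1.2 := by
    by_contra! hclose
    exact hbetween _ ⟨hlower, hclose⟩ (h.next w).2
  have hdist : |(h.next w).1.2 - (h.next z).1.2| < δ := abs_lt.2 ⟨by linarith, by linarith⟩
  exact hdist

lemma isLocalHomeomorph_next (h : IsGlobalCrossSection φ H) : IsLocalHomeomorph h.next :=
  .of_comp (f := h.next) (g := proj φ H) h.isLocalHomeomorph_proj h.isLocalHomeomorph_proj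
    h.continuous_next

/-- The generator of the deck group of the space of hitting times. -/
noncomputable def nextHomeomorph (h : IsGlobalCrossSection φ H) :
    HittingTimes φ H ≃ₜ HittingTimes φ H :=
  h.isLocalHomeomorph_next.toHomeomorphOfBijective h.bijective_next

/-- The deck group of the space of hitting times. -/
noncomputable abbrev deckGroup (h : IsGlobalCrossSection φ H) :
    Subgroup (Equiv.Perm (HittingTimes φ H)) :=
  Subgroup.zpowers h.nextHomeomorph.toEquiv

lemma nextHomeomorph_apply (h : IsGlobalCrossSection φ H) (z : HittingTimes φ H) :
    h.nextHomeomorph.toEquiv z = h.next z := rfl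

lemma continuous_nextHomeomorph_zpow (h : IsGlobalCrossSection φ H) (n : ℤ) :
    Continuous (h.nextHomeomorph.toEquiv ^ n) := by
  induction n with
  | zero => exact continuous_id
  | succ n ih => rw [zpow_add_one]; exact ih.comp h.nextHomeomorph.continuous
  | pred n ih => rw [zpow_sub_one]; exact ih.comp h.nextHomeomorph.symm.continuous

lemma proj_nextHomeomorph_zpow (h : IsGlobalCrossSection φ H) (n : ℤ) (z : HittingTimes φ H) :
    proj φ H ((h.nextHomeomorph.toEquiv ^ n) z) = proj φ H z := by
  induction n generalizing z with
  | zero => rfl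
  | succ n ih => rw [zpow_add_one, Equiv.Perm.mul_apply, ih, nextHomeomorph_apply, proj_next]
  | pred n ih =>
    rw [zpow_sub_one, Equiv.Perm.mul_apply, ih, ← proj_next h, ← nextHomeomorph_apply,
      ← Equiv.Perm.mul_apply, mul_inv_cancel, Equiv.Perm.one_apply]

lemma strictMono_nextHomeomorph_zpow (h : IsGlobalCrossSection φ H) (z : HittingTimes φ H) :
    StrictMono fun n : ℤ ↦ ((h.nextHomeomorph.toEquiv ^ n) z).1.2 := by
  refine strictMono_int_of_lt_succ fun n ↦ ?_
  rw [add_comm, zpow_one_add, Equiv.Perm.mul_apply]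
  exact h.lt_next _

lemma exists_nextHomeomorph_zpow_eq_of_le (h : IsGlobalCrossSection φ H) {z w : HittingTimes φ H}
    (hzw : proj φ H z = proj φ H w) (hle : z.1.2 ≤ w.1.2) :
    ∃ n : ℤ, (h.nextHomeomorph.toEquiv ^ n) z = w := by
  let u : ℤ → HittingTimes φ H := fun n ↦ (h.nextHomeomorph.toEquiv ^ n) z
  have hmono : StrictMono fun n ↦ (u n).1.2 := h.strictMono_nextHomeomorph_zpow z
  have hproj : ∀ n, proj φ H (u n) = proj φ H w := fun n ↦
    (h.proj_nextHomeomorph_zpow n z).trans hzw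
  have hfin : {n : ℤ | 0 ≤ n ∧ (u n).1.2 ≤ w.1.2}.Finite := by
    refine ((h.finite_hits_inter_Icc w.1.1 z.1.2 w.1.2).preimage hmono.injective.injOn).subset ?_
    rintro n ⟨hn, hnw⟩
    exact ⟨mem_of_proj_eq (hproj n), hmono.monotone hn, hnw⟩
  obtain ⟨n, ⟨hn, hnw⟩, hmax⟩ := hfin.isCompact.exists_isGreatest ⟨0, le_rfl, hle⟩
  refine ⟨n, Subtype.ext (Prod.ext (hproj n) (hnw.antisymm ?_))⟩
  by_contra! hlt
  have hnext : (u (1 + n)).1.2 ≤ w.1.2 := by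
    simp only [u, zpow_one_add]
    exact h.next_le (hproj n) hlt
  linarith [hmax ⟨by linarith, hnext⟩]

lemma proj_eq_iff_mem_orbit (h : IsGlobalCrossSection φ H) {z w : HittingTimes φ H} :
    proj φ H z = proj φ H w ↔ z ∈ MulAction.orbit h.deckGroup w := by
  refine ⟨fun hzw ↦ ?_, ?_⟩
  · rcases le_total z.1.2 w.1.2 with hle | hle
    · obtain ⟨n, hn⟩ := h.exists_nextHomeomorph_zpow_eq_of_le hzw hle
      exact MulAction.mem_orbit_symm.1 ⟨⟨_, n, rfl⟩, hn⟩
    · obtain ⟨n, hn⟩ := h.exists_nextHomeomorph_zpow_eq_of_le hzw.symm hle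
      exact ⟨⟨_, n, rfl⟩, hn⟩
  · rintro ⟨⟨_, n, rfl⟩, rfl⟩
    exact h.proj_nextHomeomorph_zpow n w

lemma isQuotientCoveringMap_proj (h : IsGlobalCrossSection φ H) :
    IsQuotientCoveringMap (proj φ H) h.deckGroup where
  __ := h.isOpenMap_proj.isQuotientMap continuous_proj h.surjective_proj
  continuous_const_smul := by
    rintro ⟨_, n, rfl⟩
    exact h.continuous_nextHomeomorph_zpow n
  apply_eq_iff_mem_orbit := h.proj_eq_iff_mem_orbit
  disjoint z := by
    obtain ⟨U, hU, hinj⟩ := h.exists_injOn_proj z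
    refine ⟨U, hU, ?_⟩
    rintro ⟨_, n, rfl⟩ ⟨_, ⟨w, hw, rfl⟩, hw'⟩
    have hfix : (h.nextHomeomorph.toEquiv ^ n) w = (h.nextHomeomorph.toEquiv ^ (0 : ℤ)) w :=
      hinj hw' hw (h.proj_nextHomeomorph_zpow n w)
    have hn : n = 0 := (h.strictMono_nextHomeomorph_zpow w).injective (congrArg (·.1.2) hfix)
    exact Subtype.ext (by simp only [hn, zpow_zero, Subgroup.coe_one])

lemma eq_zero_of_homotopic_refl (h : IsGlobalCrossSection φ H) {x : X} {T : ℝ} {γ : Path x x}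
    (hγ : ∀ s : unitInterval, γ s = φ (s * T) x) (hom : γ.Homotopic (Path.refl x)) : T = 0 := by
  have cov := h.isQuotientCoveringMap_proj.isCoveringMap
  obtain ⟨t, -, ht⟩ := h.forward x
  let lift : C(unitInterval, HittingTimes φ H) :=
    ⟨fun s ↦ ⟨(φ (s * T) x, t - s * T), by simpa [← Flow.map_add] using ht⟩, by fun_prop⟩
  have hstart : γ 0 = proj φ H ⟨(x, t), ht⟩ := γ.source
  have hlift : lift = cov.liftPath γ.toContinuousMap ⟨(x, t), ht⟩ hstart :=
    (cov.eq_liftPath_iff' hstart).2 ⟨funext fun s ↦ (hγ s).symm, by simp [lift]⟩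
  have hend := cov.liftPath_apply_one_eq_of_homotopicRel hom ⟨(x, t), ht⟩ hstart rfl
  rw [← hlift] at hend
  have hconst := cov.liftPath_const (x := x) (e := ⟨(x, t), ht⟩) rfl
  have htime : t - 1 * T = t := congrArg (·.1.2) (hend.trans (DFunLike.congr_fun hconst 1))
  linarith

theorem eq_zero_of_simplyConnectedSpace (h : IsGlobalCrossSection φ H) {D : Type*}
    [TopologicalSpace D] [SimplyConnectedSpace D] (d : C(D, X)) {w : D} (ℓ : Path w w) {T : ℝ}
    (hℓ : ∀ s : unitInterval, d (ℓ s) = φ (s * T) (d w)) : T = 0 :=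
  h.eq_zero_of_homotopic_refl (γ := ℓ.map d.continuous) hℓ
    ((SimplyConnectedSpace.paths_homotopic ℓ (Path.refl w)).map d)

end IsGlobalCrossSection

section InverseFunction

variable {E H E' G M N : Type*} [NormedAddCommGroup E] [NormedSpace ℝ E] [NormedAddCommGroup E']
  [NormedSpace ℝ E'] [TopologicalSpace H] [TopologicalSpace G] [TopologicalSpace M]
  [TopologicalSpace N] [ChartedSpace H M] [ChartedSpace G N] {I : ModelWithCorners ℝ E H}
  {J : ModelWithCorners ℝ E' G} {n : WithTop ℕ∞} {g : M → N} {p : M}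

lemma exists_injOn_of_hasStrictFDerivAt_injective [FiniteDimensional ℝ E] {g : E → E'}
    {g' : E →L[ℝ] E'} {a : E} (hg : HasStrictFDerivAt g g' a) (hinj : Function.Injective g') :
    ∃ U ∈ 𝓝 a, InjOn g U := by
  obtain ⟨K, hK, hanti⟩ := (g' : E →ₗ[ℝ] E').exists_antilipschitzWith (LinearMap.ker_eq_bot.2 hinj)
  have hclose := hg.isLittleO.def (c := (K : ℝ)⁻¹ / 2) (by positivity)
  rw [nhds_prod_eq] at hclose
  obtain ⟨U, hU, hUU⟩ := mem_prod_self_iff.1 hclose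
  refine ⟨U, hU, fun y hy z hz hyz ↦ ?_⟩
  have hle : ‖g' (y - z)‖ ≤ (K : ℝ)⁻¹ / 2 * ‖y - z‖ := by
    simpa only [mem_ofPred_eq, hyz, sub_self, zero_sub, norm_neg] using hUU (mk_mem_prod hy hz)
  have hge : ‖y - z‖ ≤ K * ‖g' (y - z)‖ := hanti.le_mul_norm (map_zero g') (y - z)
  have hhalf : K * ((K : ℝ)⁻¹ / 2 * ‖y - z‖) = ‖y - z‖ / 2 := by field_simp
  have hnorm : ‖y - z‖ ≤ ‖y - z‖ / 2 := by
    rw [← hhalf]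
    exact hge.trans (by gcongr)
  exact sub_eq_zero.1 (norm_le_zero_iff.1 (by linarith))

lemma hasStrictFDerivAt_writtenInExtChartAt (hg : ContMDiffAt I J n g p) (hn : n ≠ 0)
    (hp : I.IsInteriorPoint p) :
    HasStrictFDerivAt (writtenInExtChartAt I J p g) (mfderiv I J g p : E →L[ℝ] E')
      (extChartAt I p p) := by
  have hsmooth : ContDiffAt ℝ n (writtenInExtChartAt I J p g) (extChartAt I p p) :=
    (contMDiffAt_iff.1 hg).2.contDiffAt (range_mem_nhds_isInteriorPoint hp)
  have hderiv : (mfderiv I J g p : E →L[ℝ] E') =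
      fderiv ℝ (writtenInExtChartAt I J p g) (extChartAt I p p) :=
    (hg.mdifferentiableAt hn).mfderiv.trans
      (fderivWithin_of_mem_nhds (range_mem_nhds_isInteriorPoint hp))
  exact hderiv ▸ hsmooth.hasStrictFDerivAt hn

lemma exists_injOn_of_mfderiv_injective [FiniteDimensional ℝ E] (hg : ContMDiffAt I J n g p)
    (hn : n ≠ 0) (hp : I.IsInteriorPoint p) (hinj : Function.Injective (mfderiv I J g p)) :
    ∃ U ∈ 𝓝 p, InjOn g U := by
  obtain ⟨V, hV, hinjOn⟩ := exists_injOn_of_hasStrictFDerivAt_injective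
    (hasStrictFDerivAt_writtenInExtChartAt hg hn hp) hinj
  refine ⟨_, ((continuousAt_extChartAt p).eventually hV).and (extChartAt_source_mem_nhds p),
    fun y ⟨hyV, hy⟩ z ⟨hzV, hz⟩ hyz ↦ (extChartAt I p).injOn hy hz (hinjOn hyV hzV ?_)⟩
  simp only [writtenInExtChartAt, Function.comp_apply, (extChartAt I p).left_inv hy,
    (extChartAt I p).left_inv hz, hyz]

lemma map_nhds_eq_of_mfderiv_surjective [CompleteSpace E] [CompleteSpace E']
    (hg : ContMDiffAt I J n g p) (hn : n ≠ 0) (hp : I.IsInteriorPoint p)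
    (hsurj : Function.Surjective (mfderiv I J g p)) : map g (𝓝 p) = 𝓝 (g p) := by
  have hgp : J.IsInteriorPoint (g p) :=
    (hg.mdifferentiableAt hn).isInteriorPoint_of_surjective_mfderiv hsurj hp
  have hdom : map (extChartAt I p) (𝓝 p) = 𝓝 (extChartAt I p p) := by
    rw [map_extChartAt_nhds, nhdsWithin_eq_nhds.2 (range_mem_nhds_isInteriorPoint hp)]
  have hcod : map (extChartAt J (g p)).symm (𝓝 (extChartAt J (g p) (g p))) = 𝓝 (g p) := by
    rw [← nhdsWithin_eq_nhds.2 (range_mem_nhds_isInteriorPoint hgp),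
      map_extChartAt_symm_nhdsWithin_range]
  have hmid := (hasStrictFDerivAt_writtenInExtChartAt hg hn hp).map_nhds_eq_of_surj
    (LinearMap.range_eq_top.2 hsurj)
  have hval : writtenInExtChartAt I J p g (extChartAt I p p) = extChartAt J (g p) (g p) := by
    simp only [writtenInExtChartAt, Function.comp_apply, extChartAt_to_inv]
  have hfactor : (extChartAt J (g p)).symm ∘ writtenInExtChartAt I J p g ∘ extChartAt I p
      =ᶠ[𝓝 p] g := by
    filter_upwards [extChartAt_source_mem_nhds (I := I) p,
      hg.continuousAt.eventually (extChartAt_source_mem_nhds (I := J) (g p))] with q hq hgq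
    simp only [writtenInExtChartAt, Function.comp_apply, (extChartAt I p).left_inv hq,
      (extChartAt J (g p)).left_inv hgq]
  rw [← map_congr hfactor, ← map_map, ← map_map, hdom, hmid, hval, hcod]

lemma surjective_mfderiv_of_injective [FiniteDimensional ℝ E] [FiniteDimensional ℝ E']
    (hdim : Module.finrank ℝ E = Module.finrank ℝ E')
    (hinj : Function.Injective (mfderiv I J g p)) : Function.Surjective (mfderiv I J g p) :=
  let L : E →L[ℝ] E' := mfderiv I J g p
  (LinearMap.injective_iff_surjective_of_finrank_eq_finrank (f := L.toLinearMap) hdim).1 hinj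

lemma mdifferentiable_of_mem_maximalAtlas [IsManifold I 1 M] {e : OpenPartialHomeomorph M H}
    (he : e ∈ IsManifold.maximalAtlas I 1 M) : e.MDifferentiable I I :=
  ⟨fun _ hx ↦ (mdifferentiableAt_of_mem_maximalAtlas he hx).mdifferentiableWithinAt,
    fun _ hx ↦ (mdifferentiableAt_symm_of_mem_maximalAtlas he hx).mdifferentiableWithinAt⟩

lemma injective_mfderiv_of_isImmersionAt [IsManifold I 1 M] [IsManifold J 1 N]
    (h : IsImmersionAt I J n g p) (hn : 1 ≤ n) : Function.Injective (mfderiv I J g p) := by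
  have hdom := mdifferentiable_of_mem_maximalAtlas
    (IsManifold.maximalAtlas_subset_of_le hn h.domChart_mem_maximalAtlas)
  have hcod := mdifferentiable_of_mem_maximalAtlas
    (IsManifold.maximalAtlas_subset_of_le hn h.codChart_mem_maximalAtlas)
  have hg : MDifferentiableAt I J g p := h.contMDiffAt.mdifferentiableAt (by positivity)
  have hcodDiff : MDifferentiableAt J 𝓘(ℝ, E') (h.codChart.extend J) (g p) :=
    (J.hasMFDerivAt (x := h.codChart (g p))).mdifferentiableAt.comp (g p)
      (hcod.mdifferentiableAt h.mem_codChart_source)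
  have hdomDeriv : HasMFDerivAt I 𝓘(ℝ, E) (h.domChart.extend I) p (mfderiv I I h.domChart p) :=
    (I.hasMFDerivAt (x := h.domChart p)).comp p
      (hdom.mdifferentiableAt h.mem_domChart_source).hasMFDerivAt
  let P : E' →L[ℝ] E := (ContinuousLinearMap.fst ℝ E h.complement).comp
    (h.equiv.symm : E' →L[ℝ] E × h.complement)
  have hleft : P ∘ h.codChart.extend J ∘ g =ᶠ[𝓝 p] h.domChart.extend I := by
    filter_upwards [h.domChart.open_source.mem_nhds h.mem_domChart_source] with q hq
    have hq' := h.writtenInCharts ((h.domChart.extend I).map_source (by simpa using hq))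
    simp_all [P]
  have hcomp := P.hasMFDerivAt.comp p (hcodDiff.hasMFDerivAt.comp p hg.hasMFDerivAt)
  have hderiv := hasMFDerivAt_unique (hcomp.congr_of_eventuallyEq hleft.symm) hdomDeriv
  have hinj := hdom.mfderiv_injective h.mem_domChart_source
  rw [← hderiv] at hinj
  exact Function.Injective.of_comp (f := P ∘ mfderiv J 𝓘(ℝ, E') (h.codChart.extend J) (g p)) hinj

end InverseFunction

section FlowBox

variable {X M : Type*} [TopologicalSpace X] [TopologicalSpace M] {φ : Flow ℝ X} {f : M → X} {p : M}

lemma eventually_existsUnique_hit (hf : IsEmbedding f) {S : Set M} (hS : S ∈ 𝓝 p)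
    (hopen : map (fun q : M × ℝ ↦ φ q.2 (f q.1)) (𝓝 (p, 0)) = 𝓝 (f p))
    (hinj : ∃ U ∈ 𝓝 (p, (0 : ℝ)), InjOn (fun q : M × ℝ ↦ φ q.2 (f q.1)) U) :
    ∀ᶠ ε in 𝓝[>] (0 : ℝ), ∀ᶠ y in 𝓝 (f p), ∃! t, |t| < ε ∧ φ t y ∈ f '' S := by
  obtain ⟨U, hU, hinj⟩ := hinj
  obtain ⟨A, hA, B, hB, hAB⟩ := mem_nhds_prod_iff.1 hU
  rw [hf.nhds_eq_comap] at hA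
  obtain ⟨O, hO, hOA⟩ := hA
  have hflow : Tendsto (fun z : X × ℝ ↦ φ z.2 z.1) (𝓝 (f p, 0)) (𝓝 (f p)) := by
    simpa using (by fun_prop : Continuous fun z : X × ℝ ↦ φ z.2 z.1).tendsto (f p, 0)
  obtain ⟨V, hV, C, hC, hVC⟩ := mem_nhds_prod_iff.1 (hflow hO)
  obtain ⟨δ, hδ, hball⟩ := Metric.mem_nhds_iff.1 (inter_mem hB hC)
  filter_upwards [self_mem_nhdsWithin, nhdsWithin_le_nhds (gt_mem_nhds hδ)] with ε hpos hεδ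
  have hsmall : ∀ {t : ℝ}, |t| < ε → t ∈ B ∩ C := fun ht ↦
    hball (by simpa using ht.trans hεδ)
  have hhit : ∀ᶠ y in 𝓝 (f p), ∃ q ∈ S, ∃ s : ℝ, |s| < ε ∧ φ s (f q) = y := by
    rw [← hopen, eventually_map]
    filter_upwards [prod_mem_nhds hS (ball_mem_nhds (0 : ℝ) hpos)] with q ⟨hq, hs⟩
    exact ⟨q.1, hq, q.2, by simpa using hs, rfl⟩
  filter_upwards [hV, hhit] with y hy ⟨q, hq, s, hs, hsy⟩
  have hback : φ (-s) y = f q := by rw [← hsy, ← Flow.map_add, neg_add_cancel, Flow.map_zero_apply]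
  have hmem : ∀ {q' : M} {t : ℝ}, |t| < ε → f q' = φ t y → (q', -t) ∈ U := fun {q' t} ht hq' ↦
    hAB ⟨hOA (show f q' ∈ O from hq' ▸ hVC (mk_mem_prod hy (hsmall ht).2)),
      (hsmall (by rwa [abs_neg])).1⟩
  refine ⟨-s, ⟨by rwa [abs_neg], q, hq, hback.symm⟩, ?_⟩
  rintro t ⟨ht, q', -, hq'⟩
  have heq := hinj (hmem ht hq') (hmem (by rwa [abs_neg]) hback.symm) (by
    simp only [hq', ← hback, ← Flow.map_add, neg_add_cancel])
  exact neg_injective (congrArg Prod.snd heq)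

end FlowBox

section Transversality

lemma mvfderiv_prod_real_apply {E H M F : Type*} [NormedAddCommGroup E] [NormedSpace ℝ E]
    [TopologicalSpace H] [TopologicalSpace M] [ChartedSpace H M] {I : ModelWithCorners ℝ E H}
    [NormedAddCommGroup F] [NormedSpace ℝ F] {g : M × ℝ → F} {p : M} {t : ℝ} {X : F}
    (hg : MDifferentiableAt (I.prod 𝓘(ℝ)) 𝓘(ℝ, F) g (p, t))
    (hX : HasDerivAt (fun s ↦ g (p, s)) X t) (v : E) (s : ℝ) :
    mvfderiv (I.prod 𝓘(ℝ)) g (p, t) (v, s) = mvfderiv I (fun q ↦ g (q, t)) p v + s • X := by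
  have htime : mvfderiv 𝓘(ℝ) (fun s ↦ g (p, s)) t s = s • X := by
    simp only [mvfderiv, mfderiv_eq_fderiv, hX.hasFDerivAt.fderiv]
    rfl
  exact (mfderiv_prod_eq_add_apply (v := (v, s)) hg).trans (congrArg _ htime)

lemma contMDiff_coe_threeSphere {n : WithTop ℕ∞} :
    ContMDiff (𝓡 3) 𝓘(ℝ, EuclideanSpace ℝ (Fin 4)) n
      ((↑) : ThreeSphere → EuclideanSpace ℝ (Fin 4)) :=
  have := Fact.mk (@finrank_euclideanSpace_fin ℝ _ 4)
  contMDiff_coe_sphere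

lemma injective_mvfderiv_coe_threeSphere (x : ThreeSphere) :
    Function.Injective (mvfderiv (𝓡 3) ((↑) : ThreeSphere → EuclideanSpace ℝ (Fin 4)) x) :=
  have := Fact.mk (@finrank_euclideanSpace_fin ℝ _ 4)
  injective_mvfderiv_subtypeVal_sphere (n := 3) x

variable {E H M : Type*} [NormedAddCommGroup E] [NormedSpace ℝ E] [TopologicalSpace H]
  [TopologicalSpace M] [ChartedSpace H M] {I : ModelWithCorners ℝ E H} {f : M → ThreeSphere} {p : M}
  {n : WithTop ℕ∞} {R : ThreeSphere → EuclideanSpace ℝ (Fin 4)} {φ : Flow ℝ ThreeSphere}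

lemma injective_mvfderiv_coe_comp_iff (hf : MDifferentiableAt I (𝓡 3) f p) :
    Function.Injective (mvfderiv I (fun q ↦ (f q : EuclideanSpace ℝ (Fin 4))) p) ↔
      Function.Injective (mfderiv I (𝓡 3) f p) := by
  have hcomp : mvfderiv I (fun q ↦ (f q : EuclideanSpace ℝ (Fin 4))) p =
      (mvfderiv (𝓡 3) ((↑) : ThreeSphere → EuclideanSpace ℝ (Fin 4)) (f p)).comp
        (mfderiv I (𝓡 3) f p) :=
    mfderiv_comp p (contMDiff_coe_threeSphere.mdifferentiableAt one_ne_zero) hf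
  rw [hcomp]
  exact (injective_mvfderiv_coe_threeSphere (f p)).of_comp_iff _

lemma contMDiffAt_flow_comp
    (hφ : ContMDiff (𝓘(ℝ).prod (𝓡 3)) (𝓡 3) n fun z : ℝ × ThreeSphere ↦ φ z.1 z.2)
    (hf : ContMDiffAt I (𝓡 3) n f p) (t : ℝ) :
    ContMDiffAt (I.prod 𝓘(ℝ)) (𝓡 3) n (fun q : M × ℝ ↦ φ q.2 (f q.1)) (p, t) :=
  hφ.contMDiffAt.comp (p, t) (contMDiffAt_snd.prodMk (hf.comp (p, t) contMDiffAt_fst))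

lemma injective_mfderiv_flow_comp_of_transverse
    (hφ : ContMDiff (𝓘(ℝ).prod (𝓡 3)) (𝓡 3) n fun z : ℝ × ThreeSphere ↦ φ z.1 z.2)
    (hR : IsFlowOf R φ) (hn : n ≠ 0) (hf : ContMDiffAt I (𝓡 3) n f p)
    (hinj : Function.Injective (mfderiv I (𝓡 3) f p))
    (htrans : ∀ v : TangentSpace I p,
      mvfderiv I (fun q ↦ (f q : EuclideanSpace ℝ (Fin 4))) p v ≠ R (f p)) :
    Function.Injective
      (mfderiv (I.prod 𝓘(ℝ)) (𝓡 3) (fun q : M × ℝ ↦ φ q.2 (f q.1)) (p, 0)) := by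
  let G : M × ℝ → EuclideanSpace ℝ (Fin 4) := fun q ↦ φ q.2 (f q.1)
  have hflow := (contMDiffAt_flow_comp hφ hf 0).mdifferentiableAt hn
  have hG : MDifferentiableAt (I.prod 𝓘(ℝ)) 𝓘(ℝ, EuclideanSpace ℝ (Fin 4)) G (p, 0) :=
    (contMDiff_coe_threeSphere.mdifferentiableAt one_ne_zero).comp (p, (0 : ℝ)) hflow
  have hvelocity : HasDerivAt (fun t ↦ G (p, t)) (R (f p)) 0 := by simpa using hR (f p) 0
  have hstart : (fun q ↦ G (q, 0)) = fun q ↦ (f q : EuclideanSpace ℝ (Fin 4)) :=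
    funext fun q ↦ by simp only [G, Flow.map_zero_apply]
  refine (injective_mvfderiv_coe_comp_iff hflow).1 ((injective_iff_map_eq_zero _).2 ?_)
  intro ⟨(v : TangentSpace I p), (s : ℝ)⟩ hvs
  have hzero := (mvfderiv_prod_real_apply hG hvelocity v s).symm.trans hvs
  rw [hstart] at hzero
  have hs : s = 0 := by
    by_contra hs
    refine htrans (-(s⁻¹ • v)) ?_
    rw [map_neg, map_smul, eq_neg_of_add_eq_zero_left hzero, smul_neg, inv_smul_smul₀ hs, neg_neg]
  rw [hs, zero_smul, add_zero] at hzero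
  rw [hs, (injective_iff_map_eq_zero _).1
    ((injective_mvfderiv_coe_comp_iff (hf.mdifferentiableAt hn)).2 hinj) v hzero]
  rfl

lemma eventually_existsUnique_hit_of_transverse [IsManifold I 1 M] [FiniteDimensional ℝ E]
    (hE : Module.finrank ℝ E = 2)
    (hφ : ContMDiff (𝓘(ℝ).prod (𝓡 3)) (𝓡 3) n fun z : ℝ × ThreeSphere ↦ φ z.1 z.2)
    (hR : IsFlowOf R φ) (hn : 1 ≤ n) (hf : IsSmoothEmbedding I (𝓡 3) n f)
    (hp : I.IsInteriorPoint p)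
    (htrans : ∀ v : TangentSpace I p,
      mvfderiv I (fun q ↦ (f q : EuclideanSpace ℝ (Fin 4))) p v ≠ R (f p)) {S : Set M}
    (hS : S ∈ 𝓝 p) :
    ∀ᶠ ε in 𝓝[>] (0 : ℝ), ∀ᶠ y in 𝓝 (f p), ∃! t, |t| < ε ∧ φ t y ∈ f '' S := by
  have hn0 : n ≠ 0 := (zero_lt_one.trans_le hn).ne'
  have hflow := contMDiffAt_flow_comp hφ hf.contMDiff.contMDiffAt 0 (p := p)
  have hinj := injective_mfderiv_flow_comp_of_transverse hφ hR hn0 hf.contMDiff.contMDiffAt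
    (injective_mfderiv_of_isImmersionAt (hf.isImmersion.isImmersionAt p) hn) htrans
  have hsurj : Function.Surjective
      (mfderiv (I.prod 𝓘(ℝ)) (𝓡 3) (fun q : M × ℝ ↦ φ q.2 (f q.1)) (p, 0)) :=
    surjective_mfderiv_of_injective (by simp [hE]) hinj
  have hp' : (I.prod 𝓘(ℝ)).IsInteriorPoint (p, (0 : ℝ)) := by
    have : (p, (0 : ℝ)) ∈ (I.prod 𝓘(ℝ)).interior (M × ℝ) := by
      rw [ModelWithCorners.interior_prod]
      exact ⟨hp, BoundarylessManifold.isInteriorPoint⟩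
    exact this
  refine eventually_existsUnique_hit hf.isEmbedding hS ?_
    (exists_injOn_of_mfderiv_injective hflow hn0 hp' hinj)
  simpa using map_nhds_eq_of_mfderiv_surjective hflow hn0 hp' hsurj

end Transversality

namespace IsGlobalSurfaceOfSection

variable {R : ThreeSphere → EuclideanSpace ℝ (Fin 4)} {φ : Flow ℝ ThreeSphere}
  {M : Type} [TopologicalSpace M] [ChartedSpace (EuclideanHalfSpace 2) M]
  [IsManifold (𝓡∂ 2) ∞ M] [CompactSpace M] [ConnectedSpace M] {f : M → ThreeSphere}

lemma isInvariant_compl_image_boundary (h : IsGlobalSurfaceOfSection R φ M f) :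
    IsInvariant φ (f '' (𝓡∂ 2).boundary M)ᶜ := by
  rintro t x hx ⟨p, hp, hpx⟩
  refine hx ?_
  simpa [hpx, ← Flow.map_add] using (h.boundary_periodic p hp).2 (-t)

lemma image_interior_eq_sdiff (h : IsGlobalSurfaceOfSection R φ M f) :
    f '' (𝓡∂ 2).interior M = range f \ f '' (𝓡∂ 2).boundary M := by
  rw [← (𝓡∂ 2).compl_boundary, image_compl_eq_range_sdiff_image h.embedding.isEmbedding.injective]

lemma isGlobalCrossSection (h : IsGlobalSurfaceOfSection R φ M f) (hR : IsFlowOf R φ)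
    (hφ : ContMDiff (𝓘(ℝ).prod (𝓡 3)) (𝓡 3) ∞ fun z : ℝ × ThreeSphere ↦ φ z.1 z.2) :
    IsGlobalCrossSection (φ.restrict h.isInvariant_compl_image_boundary)
      (Subtype.val ⁻¹' (f '' (𝓡∂ 2).interior M)) where
  isClosed := by
    have hrange : (Subtype.val ⁻¹' (f '' (𝓡∂ 2).interior M) : Set ↥(f '' (𝓡∂ 2).boundary M)ᶜ) =
        Subtype.val ⁻¹' range f := by
      rw [h.image_interior_eq_sdiff]
      exact Set.ext fun x ↦ and_iff_left x.2
    rw [hrange]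
    exact (isCompact_range h.embedding.contMDiff.continuous).isClosed.preimage
      continuous_subtype_val
  existsUnique_hit := by
    rintro ⟨x, hx⟩ ⟨p, hp, rfl⟩
    have hS := ((𝓡∂ 2).isOpen_interior (M := M) (n := ∞) (by simp)).mem_nhds hp
    filter_upwards [eventually_existsUnique_hit_of_transverse (by simp) hφ hR (by simp)
      h.embedding hp (h.transverse p hp) hS] with ε hε
    exact (continuous_subtype_val.tendsto (⟨f p, hx⟩ : ↥(f '' (𝓡∂ 2).boundary M)ᶜ)).eventually hε
  forward x := h.hits_forward x x.2
  backward x := h.hits_backward x x.2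

lemma exists_mem_image_boundary (h : IsGlobalSurfaceOfSection R φ M f) (hR : IsFlowOf R φ)
    (hφ : ContMDiff (𝓘(ℝ).prod (𝓡 3)) (𝓡 3) ∞ fun z : ℝ × ThreeSphere ↦ φ z.1 z.2)
    {D : Type*} [TopologicalSpace D] [SimplyConnectedSpace D] (d : C(D, ThreeSphere)) {w : D}
    (ℓ : Path w w) {T : ℝ} (hT : T ≠ 0) (hℓ : ∀ s : unitInterval, d (ℓ s) = φ (s * T) (d w)) :
    ∃ z, d z ∈ f '' (𝓡∂ 2).boundary M := by
  by_contra! hdisj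
  exact hT ((h.isGlobalCrossSection hR hφ).eq_zero_of_simplyConnectedSpace
    ⟨fun z ↦ ⟨d z, hdisj z⟩, by fun_prop⟩ ℓ fun s ↦ Subtype.ext (hℓ s))

end IsGlobalSurfaceOfSection

section OneDimensional

lemma image_mem_nhds_of_injOn_Icc {k : ℝ → ℝ} {a δ : ℝ} (hδ : 0 < δ)
    (hc : ContinuousOn k (Icc (a - δ) (a + δ))) (hinj : InjOn k (Icc (a - δ) (a + δ))) :
    k '' Icc (a - δ) (a + δ) ∈ 𝓝 (k a) := by
  have ha : a ∈ Icc (a - δ) (a + δ) := ⟨by linarith, by linarith⟩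
  have hl : a - δ ∈ Icc (a - δ) (a + δ) := ⟨le_rfl, by linarith⟩
  have hr : a + δ ∈ Icc (a - δ) (a + δ) := ⟨by linarith, le_rfl⟩
  rcases hc.strictMonoOn_of_injOn_Icc' (by linarith) hinj with h | h
  · exact mem_of_superset (Icc_mem_nhds (h hl ha (by linarith)) (h ha hr (by linarith)))
      (intermediate_value_Icc (by linarith) hc)
  · exact mem_of_superset (Icc_mem_nhds (h ha hr (by linarith)) (h hl ha (by linarith)))
      (intermediate_value_Icc' (by linarith) hc)

lemma image_mem_nhds_of_injOn {k : ℝ → ℝ} {a : ℝ} {U : Set ℝ} (hU : U ∈ 𝓝 a)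
    (hc : ContinuousOn k U) (hinj : InjOn k U) : k '' U ∈ 𝓝 (k a) := by
  obtain ⟨δ, hδ, hball⟩ := nhds_basis_closedBall.mem_iff.1 hU
  rw [Real.closedBall_eq_Icc] at hball
  exact mem_of_superset (image_mem_nhds_of_injOn_Icc hδ (hc.mono hball) (hinj.mono hball))
    (image_mono hball)

variable {X Y : Type*} [TopologicalSpace X] [TopologicalSpace Y]

lemma range_mem_nhds_of_injOn_coordinate {c : ℝ → Y} {a : ℝ} {V : Set ℝ} {U : Set Y} {k : Y → ℝ}
    (hc : Continuous c) (hV : V ∈ 𝓝 a) (hcV : InjOn c V) (hU : U ∈ 𝓝 (c a))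
    (hkU : ContinuousOn k U) (hinj : InjOn k U) : range c ∈ 𝓝 (c a) := by
  have himage : k ∘ c '' (V ∩ c ⁻¹' U) ∈ 𝓝 (k (c a)) :=
    image_mem_nhds_of_injOn (inter_mem hV (hc.continuousAt hU))
      (hkU.comp hc.continuousOn fun _ h ↦ h.2)
      (hinj.comp (hcV.mono inter_subset_left) fun _ h ↦ h.2)
  filter_upwards [hU, (hkU.continuousAt hU).eventually himage] with q hq ⟨t, ht, htq⟩
  exact ⟨t, hinj ht.2 hq htq⟩

variable {φ : Flow ℝ X}

lemma exists_injOn_orbit {x : X} (h : ∀ᶠ t in 𝓝[≠] (0 : ℝ), φ t x ≠ x) :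
    ∃ V ∈ 𝓝 (0 : ℝ), InjOn (fun t ↦ φ t x) V := by
  rw [eventually_nhdsWithin_iff] at h
  have hsub : Tendsto (fun z : ℝ × ℝ ↦ z.1 - z.2) (𝓝 (0, 0)) (𝓝 0) :=
    (by fun_prop : Continuous fun z : ℝ × ℝ ↦ z.1 - z.2).tendsto' _ _ (sub_zero 0)
  have hpairs := hsub.eventually h
  rw [nhds_prod_eq] at hpairs
  obtain ⟨V, hV, hVV⟩ := mem_prod_self_iff.1 hpairs
  refine ⟨V, hV, fun s hs t ht hst ↦ ?_⟩
  by_contra hne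
  refine hVV (mk_mem_prod hs ht) (sub_ne_zero.2 hne) ?_
  have hback : φ (-t) (φ s x) = φ (-t) (φ t x) := congrArg (φ (-t)) hst
  simpa only [← Flow.map_add, neg_add_cancel, Flow.map_zero_apply, neg_add_eq_sub] using hback

lemma preimage_orbit_mem_nhds {f : Y → X} (hf : IsEmbedding f) (hinv : IsInvariant φ (range f))
    {y : Y} (hmove : ∀ᶠ t in 𝓝[≠] (0 : ℝ), φ t (f y) ≠ f y)
    (hcurve : ∃ U ∈ 𝓝 y, ∃ k : Y → ℝ, ContinuousOn k U ∧ InjOn k U) :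
    f ⁻¹' φ.orbit (f y) ∈ 𝓝 y := by
  choose c hc using fun t ↦ hinv t ⟨y, rfl⟩
  have hc0 : c 0 = y := hf.injective (by rw [hc, Flow.map_zero_apply])
  have hcont : Continuous c := by
    rw [hf.continuous_iff, show f ∘ c = fun t ↦ φ t (f y) from funext hc]
    fun_prop
  obtain ⟨V, hV, hVinj⟩ := exists_injOn_orbit hmove
  have hcV : InjOn c V := fun s hs t ht hst ↦ hVinj hs ht (by simp only [← hc, hst])
  obtain ⟨U, hU, k, hk, hkinj⟩ := hcurve
  have hrange := range_mem_nhds_of_injOn_coordinate hcont hV hcV (hc0.symm ▸ hU) hk hkinj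
  rw [hc0] at hrange
  refine mem_of_superset hrange ?_
  rintro _ ⟨t, rfl⟩
  exact ⟨t, (hc t).symm⟩

/-- An invariant curve without stationary points is a disjoint union of open orbits. -/
lemma conserved_eq_of_preconnectedSpace [PreconnectedSpace Y] {Z : Type*} {m : X → Z}
    (hm : ∀ t x, m (φ t x) = m x) {f : Y → X} (hf : IsEmbedding f)
    (hinv : IsInvariant φ (range f)) (hmove : ∀ y, ∀ᶠ t in 𝓝[≠] (0 : ℝ), φ t (f y) ≠ f y)
    (hcurve : ∀ y : Y, ∃ U ∈ 𝓝 y, ∃ k : Y → ℝ, ContinuousOn k U ∧ InjOn k U) (y y' : Y) :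
    m (f y) = m (f y') := by
  have hconst : IsLocallyConstant (m ∘ f) := by
    refine (IsLocallyConstant.iff_eventually_eq _).2 fun z ↦ ?_
    filter_upwards [preimage_orbit_mem_nhds hf hinv (hmove z) (hcurve z)] with w ⟨t, ht⟩
    exact (congrArg m ht).symm.trans (hm t (f z))
  exact hconst.apply_eq_of_preconnectedSpace y y'

end OneDimensional

section SurfaceBoundary

variable {M : Type*} [TopologicalSpace M] [ChartedSpace (EuclideanHalfSpace 2) M]
  [IsManifold (𝓡∂ 2) 1 M]

lemma extChartAt_apply_zero_of_mem_boundary {p q : M} (hq : q ∈ (𝓡∂ 2).boundary M)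
    (hqp : q ∈ (extChartAt (𝓡∂ 2) p).source) : extChartAt (𝓡∂ 2) p q 0 = 0 := by
  have hrange : extChartAt (𝓡∂ 2) p q ∈ range (𝓡∂ 2) := mem_range_self _
  rw [range_modelWithCornersEuclideanHalfSpace] at hrange
  refine le_antisymm (not_lt.1 fun hpos ↦ ?_) hrange
  rw [extChartAt_source] at hqp
  have hchart : extChartAt (𝓡∂ 2) p q ∈ interior ((chartAt _ p).extend (𝓡∂ 2)).target := by
    refine (chartAt _ p).mem_interior_extend_target ((chartAt _ p).map_source hqp) ?_
    rw [interior_range_modelWithCornersEuclideanHalfSpace]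
    exact hpos
  have hinterior : (𝓡∂ 2).IsInteriorPoint q :=
    ((𝓡∂ 2).isInteriorPoint_iff_of_mem_atlas one_ne_zero (chart_mem_atlas _ p) hqp).2 hchart
  exact ((𝓡∂ 2).isInteriorPoint_iff_not_isBoundaryPoint q).1 hinterior hq

lemma exists_injOn_boundary_coordinate (p : (𝓡∂ 2).boundary M) :
    ∃ U ∈ 𝓝 p, ∃ k : (𝓡∂ 2).boundary M → ℝ, ContinuousOn k U ∧ InjOn k U := by
  refine ⟨_, continuous_subtype_val.continuousAt (extChartAt_source_mem_nhds (I := 𝓡∂ 2) (p : M)),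
    fun q ↦ extChartAt (𝓡∂ 2) (p : M) q 1, ?_, fun q hq q' hq' heq ↦ Subtype.ext ?_⟩
  · exact (by fun_prop : Continuous fun u : EuclideanSpace ℝ (Fin 2) ↦ u 1).comp_continuousOn
      ((continuousOn_extChartAt (p : M)).comp continuous_subtype_val.continuousOn fun _ h ↦ h)
  · refine (extChartAt (𝓡∂ 2) (p : M)).injOn hq hq' (PiLp.ext (Fin.forall_fin_two.2 ⟨?_, heq⟩))
    rw [extChartAt_apply_zero_of_mem_boundary q.2 hq,
      extChartAt_apply_zero_of_mem_boundary q'.2 hq']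

end SurfaceBoundary

section Parametrization

variable {E H M : Type*} [NormedAddCommGroup E] [NormedSpace ℝ E] [TopologicalSpace H]
  [TopologicalSpace M] [ChartedSpace H M] {I : ModelWithCorners ℝ E H} {g : E → M} {x : E}

lemma exists_continuous_rightInverse_of_bijOn {X : Type*} [TopologicalSpace X] [T2Space M]
    {g : X → M} {K : Set X} (hK : IsCompact K) (hg : ContinuousOn g K) (hbij : BijOn g K univ) :
    ∃ G : M → X, Continuous G ∧ (∀ q, G q ∈ K) ∧ ∀ q, g (G q) = q := by
  have : CompactSpace K := isCompact_iff_compactSpace.1 hK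
  have hb : Function.Bijective (K.domRestrict g) :=
    ⟨injOn_iff_injective.1 hbij.injOn, fun q ↦
      let ⟨x, hx, hxq⟩ := hbij.surjOn (mem_univ q); ⟨⟨x, hx⟩, hxq⟩⟩
  have hc : Continuous (Equiv.ofBijective _ hb) := hg.domRestrict
  let e := hc.homeoOfEquivCompactToT2
  exact ⟨fun q ↦ e.symm q, continuous_subtype_val.comp e.symm.continuous, fun q ↦ (e.symm q).2,
    fun q ↦ e.apply_symm_apply q⟩

lemma isInteriorPoint_of_surjective_mfderivWithin [IsManifold I 1 M] {K : Set E}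
    (hg : MDifferentiableWithinAt 𝓘(ℝ, E) I g K x) (hK : K ∈ 𝓝 x)
    (hsurj : Function.Surjective (mfderivWithin 𝓘(ℝ, E) I g K x)) : I.IsInteriorPoint (g x) := by
  rw [mfderivWithin_of_mem_nhds hK] at hsurj
  exact (hg.mdifferentiableAt hK).isInteriorPoint_of_surjective_mfderiv hsurj
    BoundarylessManifold.isInteriorPoint

lemma hasFDerivWithinAt_extChartAt_comp {K : Set E}
    (hg : MDifferentiableWithinAt 𝓘(ℝ, E) I g K x) :
    HasFDerivWithinAt (extChartAt I (g x) ∘ g) (mfderivWithin 𝓘(ℝ, E) I g K x : E →L[ℝ] E) K x := by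
  have hdomain : (extChartAt 𝓘(ℝ, E) x).symm ⁻¹' K ∩ range 𝓘(ℝ, E) = K := by
    simp only [mfld_simps]
    rfl
  have hderiv := hg.hasMFDerivWithinAt.2
  rw [hdomain] at hderiv
  exact hderiv

lemma hasFDerivAt_comp_extChartAt_symm {K : Set E} {G : M → E}
    (hg : MDifferentiableWithinAt 𝓘(ℝ, E) I g K x) (hG : Continuous G) (hGK : ∀ q, G q ∈ K)
    (hgG : ∀ q, g (G q) = q) (hGx : G (g x) = x) (hint : I.IsInteriorPoint (g x)) {A : E ≃L[ℝ] E}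
    (hA : (A : E →L[ℝ] E) = mfderivWithin 𝓘(ℝ, E) I g K x) :
    HasFDerivAt (G ∘ (extChartAt I (g x)).symm) (A.symm : E →L[ℝ] E)
      (extChartAt I (g x) (g x)) := by
  have hval : (G ∘ (extChartAt I (g x)).symm) (extChartAt I (g x) (g x)) = x := by
    rw [Function.comp_apply, extChartAt_to_inv, hGx]
  have hcont : ContinuousAt (G ∘ (extChartAt I (g x)).symm) (extChartAt I (g x) (g x)) :=
    hG.continuousAt.comp (continuousAt_extChartAt_symm (g x))
  have htarget : (extChartAt I (g x)).target ∈ 𝓝 (extChartAt I (g x) (g x)) := by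
    simpa only [nhdsWithin_eq_nhds.2 (range_mem_nhds_isInteriorPoint hint)] using
      extChartAt_target_mem_nhdsWithin (I := I) (g x)
  rw [← hasFDerivWithinAt_univ]
  refine HasFDerivWithinAt.of_local_left_inverse (t := K) (f := extChartAt I (g x) ∘ g)
    ?_ ?_ (mem_univ _) ?_
  · rw [nhdsWithin_univ]
    exact tendsto_nhdsWithin_iff.2 ⟨hcont, .of_forall fun u ↦ hGK _⟩
  · rw [hval, hA]
    exact hasFDerivWithinAt_extChartAt_comp hg
  · rw [nhdsWithin_univ]
    filter_upwards [htarget] with u hu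
    simp only [Function.comp_apply, hgG, (extChartAt I (g x)).right_inv hu]

end Parametrization

section DiskBoundary

lemma eq_zero_of_isLocalMax_norm_of_surjective {E F : Type*} [NormedAddCommGroup E]
    [NormedSpace ℝ E] [NormedAddCommGroup F] [InnerProductSpace ℝ F] {k : E → F} {k' : E →L[ℝ] F}
    {a : E} (hk : HasFDerivAt k k' a) (hsurj : Function.Surjective k')
    (hmax : IsLocalMax (‖k ·‖) a) : k a = 0 := by
  have hsq : IsLocalMax (‖k ·‖ ^ 2) a := by
    filter_upwards [hmax] with u hu
    gcongr
  obtain ⟨v, hv⟩ := hsurj (k a)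
  have hzero := congrArg (fun L : E →L[ℝ] ℝ ↦ L v) (hsq.hasFDerivAt_eq_zero hk.norm_sq)
  simpa [hv] using hzero

variable {E H M : Type*} [NormedAddCommGroup E] [InnerProductSpace ℝ E] [TopologicalSpace H]
  [TopologicalSpace M] [ChartedSpace H M] {I : ModelWithCorners ℝ E H} {g : E → M} {x : E}

/-- Otherwise the norm of the inverse of `g` in a chart would have a local maximum at a point where
the derivative of the inverse is surjective. -/
lemma isBoundaryPoint_of_mem_sphere [T2Space M] [FiniteDimensional ℝ E] {r : ℝ} (hr : r ≠ 0)
    (hg : MDifferentiableOn 𝓘(ℝ, E) I g (closedBall 0 r)) (hbij : BijOn g (closedBall 0 r) univ)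
    (hx : x ∈ sphere (0 : E) r)
    (hderiv : Function.Bijective (mfderivWithin 𝓘(ℝ, E) I g (closedBall 0 r) x)) :
    I.IsBoundaryPoint (g x) := by
  rw [ModelWithCorners.isBoundaryPoint_iff_not_isInteriorPoint]
  intro hint
  have hxb : x ∈ closedBall (0 : E) r := sphere_subset_closedBall hx
  obtain ⟨G, hG, hGK, hgG⟩ :=
    exists_continuous_rightInverse_of_bijOn (isCompact_closedBall _ _) hg.continuousOn hbij
  have hGx : G (g x) = x := hbij.injOn (hGK _) hxb (hgG _)
  let L : E →L[ℝ] E := mfderivWithin 𝓘(ℝ, E) I g (closedBall 0 r) x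
  let A : E ≃L[ℝ] E := (LinearEquiv.ofBijective L.toLinearMap hderiv).toContinuousLinearEquiv
  have hinv := hasFDerivAt_comp_extChartAt_symm (hg x hxb) hG hGK hgG hGx hint (A := A) rfl
  have hval : (G ∘ (extChartAt I (g x)).symm) (extChartAt I (g x) (g x)) = x := by
    rw [Function.comp_apply, extChartAt_to_inv, hGx]
  have hmax : IsLocalMax (‖(G ∘ (extChartAt I (g x)).symm) ·‖) (extChartAt I (g x) (g x)) :=
    .of_forall fun u ↦ by
      simp only [hval, mem_sphere_zero_iff_norm.1 hx]
      exact mem_closedBall_zero_iff.1 (hGK _)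
  have hzero : x = 0 := hval ▸ eq_zero_of_isLocalMax_norm_of_surjective hinv A.symm.surjective hmax
  exact hr (by rw [← mem_sphere_zero_iff_norm.1 hx, hzero, norm_zero])

lemma boundary_eq_image_sphere [T2Space M] [IsManifold I 1 M] [FiniteDimensional ℝ E] {r : ℝ}
    (hr : r ≠ 0) (hg : MDifferentiableOn 𝓘(ℝ, E) I g (closedBall 0 r))
    (hbij : BijOn g (closedBall 0 r) univ)
    (hderiv : ∀ x ∈ closedBall 0 r,
      Function.Bijective (mfderivWithin 𝓘(ℝ, E) I g (closedBall 0 r) x)) :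
    I.boundary M = g '' sphere 0 r := by
  refine Subset.antisymm (fun q hq ↦ ?_) ?_
  · obtain ⟨x, hx, rfl⟩ := hbij.surjOn (mem_univ q)
    refine ⟨x, by_contra fun hxs ↦ ?_, rfl⟩
    have hball : x ∈ ball (0 : E) r := closedBall_sdiff_sphere (x := (0 : E)) ▸ ⟨hx, hxs⟩
    exact (I.isInteriorPoint_iff_not_isBoundaryPoint _).1
      (isInteriorPoint_of_surjective_mfderivWithin (hg x hx) (closedBall_mem_nhds_of_mem hball)
        (hderiv x hx).2) hq
  · rintro _ ⟨x, hx, rfl⟩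
    exact isBoundaryPoint_of_mem_sphere hr hg hbij hx (hderiv x (sphere_subset_closedBall hx))

lemma IsDiskLike.hasOneBoundaryComponent {M : Type} [TopologicalSpace M] [T2Space M]
    [ChartedSpace (EuclideanHalfSpace 2) M] [IsManifold (𝓡∂ 2) 1 M] (h : IsDiskLike M) :
    HasOneBoundaryComponent M := by
  obtain ⟨g, hg, hbij, hderiv⟩ := h
  rw [HasOneBoundaryComponent,
    boundary_eq_image_sphere one_ne_zero (hg.mdifferentiableOn (by simp)) hbij hderiv]
  refine (isConnected_sphere ?_ 0 zero_le_one).image g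
    (hg.continuousOn.mono sphere_subset_closedBall)
  rw [← Module.finrank_eq_rank]
  simp

end DiskBoundary

namespace IsGlobalSurfaceOfSection

variable {R : ThreeSphere → EuclideanSpace ℝ (Fin 4)} {φ : Flow ℝ ThreeSphere}
  {M : Type} [TopologicalSpace M] [ChartedSpace (EuclideanHalfSpace 2) M]
  [IsManifold (𝓡∂ 2) ∞ M] [CompactSpace M] [ConnectedSpace M] {f : M → ThreeSphere}

lemma conserved_eq_of_mem_image_boundary (h : IsGlobalSurfaceOfSection R φ M f)
    (hR : IsFlowOf R φ) (hR0 : ∀ x, R x ≠ 0) (hone : HasOneBoundaryComponent M) {Z : Type*}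
    {m : ThreeSphere → Z} (hm : ∀ t x, m (φ t x) = m x) {x y : ThreeSphere}
    (hx : x ∈ f '' (𝓡∂ 2).boundary M) (hy : y ∈ f '' (𝓡∂ 2).boundary M) : m x = m y := by
  obtain ⟨p, hp, rfl⟩ := hx
  obtain ⟨q, hq, rfl⟩ := hy
  have := Subtype.preconnectedSpace hone.isPreconnected
  have hinv : IsInvariant φ (range fun p : (𝓡∂ 2).boundary M ↦ f p) := by
    rintro t _ ⟨p, rfl⟩
    simpa only [image_eq_range] using (h.boundary_periodic p p.2).2 t
  have hmove : ∀ z, ∀ᶠ t in 𝓝[≠] (0 : ℝ), φ t z ≠ z := fun z ↦ by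
    filter_upwards [(hR z 0).eventually_ne (c := (z : EuclideanSpace ℝ (Fin 4))) (hR0 _)]
      with t ht using fun h ↦ ht (congrArg _ h)
  exact conserved_eq_of_preconnectedSpace hm (h.embedding.isEmbedding.comp .subtypeVal) hinv
    (fun z ↦ hmove (f z)) exists_injOn_boundary_coordinate ⟨p, hp⟩ ⟨q, hq⟩

/-- The boundary would meet both disks, although it lies on a single level of `m`. -/
theorem not_hasOneBoundaryComponent (h : IsGlobalSurfaceOfSection R φ M f) (hR : IsFlowOf R φ)
    (hφ : ContMDiff (𝓘(ℝ).prod (𝓡 3)) (𝓡 3) ∞ fun z : ℝ × ThreeSphere ↦ φ z.1 z.2)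
    (hR0 : ∀ x, R x ≠ 0) {Z : Type*} {m : ThreeSphere → Z} (hm : ∀ t x, m (φ t x) = m x)
    {D₁ D₂ : Type*} [TopologicalSpace D₁] [SimplyConnectedSpace D₁] [TopologicalSpace D₂]
    [SimplyConnectedSpace D₂] (d₁ : C(D₁, ThreeSphere)) (d₂ : C(D₂, ThreeSphere)) {w₁ : D₁}
    {w₂ : D₂} (ℓ₁ : Path w₁ w₁) (ℓ₂ : Path w₂ w₂) {T₁ T₂ : ℝ} (hT₁ : T₁ ≠ 0) (hT₂ : T₂ ≠ 0)
    (hℓ₁ : ∀ s : unitInterval, d₁ (ℓ₁ s) = φ (s * T₁) (d₁ w₁))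
    (hℓ₂ : ∀ s : unitInterval, d₂ (ℓ₂ s) = φ (s * T₂) (d₂ w₂))
    (hdisj : ∀ z₁ z₂, m (d₁ z₁) ≠ m (d₂ z₂)) : ¬ HasOneBoundaryComponent M := fun hone ↦
  let ⟨z₁, hz₁⟩ := h.exists_mem_image_boundary hR hφ d₁ ℓ₁ hT₁ hℓ₁
  let ⟨z₂, hz₂⟩ := h.exists_mem_image_boundary hR hφ d₂ ℓ₂ hT₂ hℓ₂
  hdisj z₁ z₂ (h.conserved_eq_of_mem_image_boundary hR hR0 hone hm hz₁ hz₂)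

end IsGlobalSurfaceOfSection

section ContactForms

variable {x u v : EuclideanSpace ℝ (Fin 4)} {ρ : EuclideanSpace ℝ (Fin 4) → ℝ}

lemma extDeriv_apply_pair {𝕜 E F : Type*} [NontriviallyNormedField 𝕜] [NormedAddCommGroup E]
    [NormedSpace 𝕜 E] [NormedAddCommGroup F] [NormedSpace 𝕜 F] {α : E → E [⋀^Fin 1]→L[𝕜] F} {x : E}
    (hα : DifferentiableAt 𝕜 α x) (u v : E) :
    extDeriv α x ![u, v] =
      fderiv 𝕜 (fun y ↦ α y ![v]) x u - fderiv 𝕜 (fun y ↦ α y ![u]) x v := by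
  have h₀ : (0 : Fin 2).removeNth ![u, v] = ![v] := by ext i; fin_cases i; rfl
  have h₁ : (1 : Fin 2).removeNth ![u, v] = ![u] := by ext i; fin_cases i; rfl
  rw [extDeriv_apply hα, Fin.sum_univ_two, h₀, h₁]
  simp [sub_eq_add_neg]

lemma real_inner_eq_sum_four (x y : EuclideanSpace ℝ (Fin 4)) :
    ⟪x, y⟫ = x 0 * y 0 + x 1 * y 1 + x 2 * y 2 + x 3 * y 3 := by
  simp [PiLp.inner_apply, Fin.sum_univ_four, mul_comm]

lemma mem_tangentPlane {x : ThreeSphere} : v ∈ tangentPlane x ↔ ⟪x.1, v⟫ = 0 :=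
  Submodule.mem_orthogonal_singleton_iff_inner_right

/-- The complex structure `mulI` as a continuous linear map. -/
noncomputable def mulICLM : EuclideanSpace ℝ (Fin 4) →L[ℝ] EuclideanSpace ℝ (Fin 4) :=
  LinearMap.toContinuousLinearMap
    { toFun := mulI
      map_add' x y := by ext i; fin_cases i <;> simp [mulI] <;> ring
      map_smul' c x := by ext i; fin_cases i <;> simp [mulI] }

lemma inner_self_mulI (x : EuclideanSpace ℝ (Fin 4)) : ⟪x, mulI x⟫ = 0 := by
  simp only [real_inner_eq_sum_four, mulI, Matrix.cons_val]; ring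

lemma inner_mulI_mulI (x v : EuclideanSpace ℝ (Fin 4)) : ⟪mulI x, mulI v⟫ = ⟪x, v⟫ := by
  simp only [real_inner_eq_sum_four, mulI, Matrix.cons_val]; ring

lemma inner_mulI_right (x v : EuclideanSpace ℝ (Fin 4)) : ⟪x, mulI v⟫ = -⟪mulI x, v⟫ := by
  simp only [real_inner_eq_sum_four, mulI, Matrix.cons_val]; ring

/-- The multiple `ρ λ` of the standard one-form `λ = x₀ dx₁ - x₁ dx₀ + x₂ dx₃ - x₃ dx₂`. -/
noncomputable def conformalForm (ρ : EuclideanSpace ℝ (Fin 4) → ℝ)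
    (x : EuclideanSpace ℝ (Fin 4)) : EuclideanSpace ℝ (Fin 4) [⋀^Fin 1]→L[ℝ] ℝ :=
  ρ x • ContinuousAlternatingMap.ofSubsingletonLIE (0 : Fin 1) (innerSL ℝ (mulICLM x))

lemma conformalForm_apply (ρ : EuclideanSpace ℝ (Fin 4) → ℝ) (x v : EuclideanSpace ℝ (Fin 4)) :
    conformalForm ρ x ![v] = ρ x * ⟪mulI x, v⟫ := rfl

lemma contDiff_conformalForm {n : WithTop ℕ∞} (hρ : ContDiff ℝ n ρ) :
    ContDiff ℝ n (conformalForm ρ) :=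
  hρ.smul ((LinearIsometryEquiv.contDiff _).comp ((innerSL ℝ).contDiff.comp mulICLM.contDiff))

lemma differentiableAt_conformalForm (hρ : DifferentiableAt ℝ ρ x) :
    DifferentiableAt ℝ (conformalForm ρ) x :=
  hρ.smul ((LinearIsometryEquiv.differentiable _).comp
    ((innerSL ℝ).differentiable.comp mulICLM.differentiable) x)

lemma fderiv_conformalForm_apply (hρ : DifferentiableAt ℝ ρ x) (u v : EuclideanSpace ℝ (Fin 4)) :
    fderiv ℝ (fun y ↦ conformalForm ρ y ![v]) x u =
      fderiv ℝ ρ x u * ⟪mulI x, v⟫ + ρ x * ⟪mulI u, v⟫ := by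
  have hlin : HasFDerivAt (fun y ↦ ⟪mulI y, v⟫) ((innerSL ℝ v).comp mulICLM) x := by
    simpa only [real_inner_comm] using! ((innerSL ℝ v).comp mulICLM).hasFDerivAt (x := x)
  refine (DFunLike.congr_fun (hρ.hasFDerivAt.mul hlin).fderiv u).trans ?_
  simp only [mulICLM, real_inner_comm, add_apply, smul_apply, ContinuousLinearMap.comp_apply,
    LinearMap.coe_toContinuousLinearMap', LinearMap.coe_mk, AddHom.coe_mk, coe_innerSL_apply,
    smul_eq_mul]
  ring

lemma extDeriv_conformalForm (hρ : DifferentiableAt ℝ ρ x) (u v : EuclideanSpace ℝ (Fin 4)) :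
    extDeriv (conformalForm ρ) x ![u, v] =
      fderiv ℝ ρ x u * ⟪mulI x, v⟫ - fderiv ℝ ρ x v * ⟪mulI x, u⟫ + 2 * ρ x * ⟪mulI u, v⟫ := by
  rw [extDeriv_apply_pair (differentiableAt_conformalForm hρ), fderiv_conformalForm_apply hρ,
    fderiv_conformalForm_apply hρ, real_inner_comm u (mulI v), inner_mulI_right]
  ring

lemma isContactFormOnSphere_conformalForm (hρ : ContDiff ℝ ∞ ρ) (hρ0 : ∀ x : ThreeSphere, ρ x ≠ 0) :
    IsContactFormOnSphere (conformalForm ρ) where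
  smooth := contDiff_conformalForm hρ
  ne_zero x := by
    refine ⟨mulI x, mem_tangentPlane.2 (inner_self_mulI _), ?_⟩
    rw [conformalForm_apply, inner_mulI_mulI, real_inner_self_eq_norm_sq, norm_eq_of_mem_sphere]
    simpa using hρ0 x
  nondegenerate x u hu hxu hu0 := by
    have hρx := hρ0 x
    have hxu : ⟪mulI x.1, u⟫ = 0 := by simpa [conformalForm_apply, hρx] using hxu
    have hx : ⟪mulI x.1, mulI u⟫ = 0 := (inner_mulI_mulI _ _).trans (mem_tangentPlane.1 hu)
    refine ⟨mulI u, mem_tangentPlane.2 ?_, ?_, ?_⟩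
    · rw [inner_mulI_right, hxu, neg_zero]
    · rw [conformalForm_apply, hx, mul_zero]
    · rw [extDeriv_conformalForm (hρ.differentiable (by simp) _), hxu, hx, inner_mulI_mulI]
      simpa [hρx] using hu0

lemma ker_conformalForm {x : ThreeSphere} (hρ : ρ x ≠ 0) :
    {v | v ∈ tangentPlane x ∧ conformalForm ρ x ![v] = 0} = standardContactPlane x := by
  simp [standardContactPlane, conformalForm_apply, hρ]

end ContactForms

section ToricForms

variable {g : ℝ → ℝ}

/-- The moment map `|z₁|² - |z₂|²` on `ℂ²`. -/
def moment (x : EuclideanSpace ℝ (Fin 4)) : ℝ := x 0 ^ 2 + x 1 ^ 2 - x 2 ^ 2 - x 3 ^ 2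

/-- The generator of the rotations of `ℂ²` with speeds `a` and `b` in the two coordinates. -/
noncomputable def torusGenerator (a b : ℝ) (x : EuclideanSpace ℝ (Fin 4)) :
    EuclideanSpace ℝ (Fin 4) :=
  !₂[-(a * x 1), a * x 0, -(b * x 3), b * x 2]

/-- The vector field on `ℂ²` which, on the level `m` of the moment map, generates the rotations with
speeds `a m` and `b m` in the two coordinates. -/
noncomputable def torusField (a b : ℝ → ℝ) (x : EuclideanSpace ℝ (Fin 4)) :
    EuclideanSpace ℝ (Fin 4) :=
  torusGenerator (a (moment x)) (b (moment x)) x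

/-- The form `g(|z₁|² - |z₂|²) λ`, with `λ` the standard contact form; it is invariant
under the rotations of both coordinates. -/
noncomputable def toricForm (g : ℝ → ℝ) :
    EuclideanSpace ℝ (Fin 4) → EuclideanSpace ℝ (Fin 4) [⋀^Fin 1]→L[ℝ] ℝ :=
  conformalForm (g ∘ moment)

/-- The speed at which the Reeb flow of `toricForm g` rotates the first coordinate of the points on
the level `m` of the moment map. -/
noncomputable def firstSpeed (g : ℝ → ℝ) (m : ℝ) : ℝ := (g m - (1 - m) * deriv g m) / g m ^ 2

/-- The speed at which the Reeb flow of `toricForm g` rotates the second coordinate of the points on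
the level `m` of the moment map. -/
noncomputable def secondSpeed (g : ℝ → ℝ) (m : ℝ) : ℝ := (g m + (1 + m) * deriv g m) / g m ^ 2

lemma contDiff_moment {n : WithTop ℕ∞} : ContDiff ℝ n moment := by
  unfold moment; fun_prop

lemma fderiv_moment_apply (x v : EuclideanSpace ℝ (Fin 4)) :
    fderiv ℝ moment x v = 2 * (x 0 * v 0 + x 1 * v 1 - (x 2 * v 2 + x 3 * v 3)) := by
  have h (i : Fin 4) : HasFDerivAt (fun y : EuclideanSpace ℝ (Fin 4) ↦ y i ^ 2) _ x :=
    (EuclideanSpace.proj (𝕜 := ℝ) i).hasFDerivAt.pow 2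
  have hm : HasFDerivAt moment _ x := (((h 0).add (h 1)).sub (h 2)).sub (h 3)
  rw [hm.fderiv]
  simp only [PiLp.proj_apply, Nat.add_one_sub_one, pow_one, nsmul_eq_mul, Nat.cast_ofNat,
    sub_apply, add_apply, smul_apply, smul_eq_mul]
  ring

lemma sum_sq_eq_one (x : ThreeSphere) : x.1 0 ^ 2 + x.1 1 ^ 2 + x.1 2 ^ 2 + x.1 3 ^ 2 = 1 := by
  simpa [Fin.sum_univ_four] using (EuclideanSpace.norm_sq_eq x.1).symm

lemma inner_self_torusGenerator (a b : ℝ) (x : EuclideanSpace ℝ (Fin 4)) :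
    ⟪x, torusGenerator a b x⟫ = 0 := by
  simp only [real_inner_eq_sum_four, torusGenerator, Matrix.cons_val]; ring

lemma inner_mulI_torusGenerator (a b : ℝ) (x : ThreeSphere) :
    ⟪mulI x, torusGenerator a b x⟫ = (a * (1 + moment x) + b * (1 - moment x)) / 2 := by
  simp only [real_inner_eq_sum_four, torusGenerator, mulI, moment, Matrix.cons_val]
  linear_combination (a + b) / 2 * sum_sq_eq_one x

lemma inner_mulI_torusGenerator_left (a b : ℝ) (x v : EuclideanSpace ℝ (Fin 4)) :
    ⟪mulI (torusGenerator a b x), v⟫ =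
      -(a * (x 0 * v 0 + x 1 * v 1) + b * (x 2 * v 2 + x 3 * v 3)) := by
  simp only [real_inner_eq_sum_four, torusGenerator, mulI, Matrix.cons_val]; ring

lemma fderiv_moment_torusGenerator (a b : ℝ) (x : EuclideanSpace ℝ (Fin 4)) :
    fderiv ℝ moment x (torusGenerator a b x) = 0 := by
  simp only [fderiv_moment_apply, torusGenerator, Matrix.cons_val]; ring

lemma firstSpeed_add_secondSpeed {m : ℝ} (hm : g m ≠ 0) :
    (firstSpeed g m * (1 + m) + secondSpeed g m * (1 - m)) / 2 = (g m)⁻¹ := by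
  simp only [firstSpeed, secondSpeed]; field_simp; ring

lemma secondSpeed_sub_firstSpeed {m : ℝ} (hm : g m ≠ 0) :
    g m * (secondSpeed g m - firstSpeed g m) = 2 * deriv g m * (g m)⁻¹ := by
  simp only [firstSpeed, secondSpeed]; field_simp; ring

lemma inner_mulI_torusField {x : ThreeSphere} (hg0 : g (moment x) ≠ 0) :
    ⟪mulI x, torusField (firstSpeed g) (secondSpeed g) x⟫ = (g (moment x))⁻¹ := by
  rw [torusField, inner_mulI_torusGenerator, firstSpeed_add_secondSpeed hg0]

lemma isReebVectorField_toricForm (hg : Differentiable ℝ g) (hg0 : ∀ m, g m ≠ 0) :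
    IsReebVectorField (toricForm g)
      (fun x ↦ torusField (firstSpeed g) (secondSpeed g) x) where
  tangent x := mem_tangentPlane.2 (inner_self_torusGenerator _ _ _)
  normalized x := by
    rw [toricForm, conformalForm_apply, inner_mulI_torusField (hg0 _)]
    exact mul_inv_cancel₀ (hg0 _)
  kernel x v hv := by
    have hmom : DifferentiableAt ℝ moment x.1 :=
      (contDiff_moment (n := 1)).differentiable (by simp) _
    have hchain (w) : fderiv ℝ (g ∘ moment) x.1 w = deriv g (moment x) * fderiv ℝ moment x w := by
      rw [fderiv_comp _ (hg _) hmom]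
      simp [mul_comm]
    have hv : x.1 2 * v 2 + x.1 3 * v 3 = -(x.1 0 * v 0 + x.1 1 * v 1) := by
      linarith [(real_inner_eq_sum_four x.1 v).symm.trans (mem_tangentPlane.1 hv)]
    rw [toricForm, extDeriv_conformalForm ((hg _).comp _ hmom), hchain, hchain,
      inner_mulI_torusField (hg0 _), torusField, fderiv_moment_torusGenerator,
      inner_mulI_torusGenerator_left, fderiv_moment_apply, hv, Function.comp_apply]
    linear_combination 2 * (x.1 0 * v 0 + x.1 1 * v 1) * secondSpeed_sub_firstSpeed (hg0 (moment x))

lemma contDiff_firstSpeed (hg : ContDiff ℝ ∞ g) (hg0 : ∀ m, g m ≠ 0) :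
    ContDiff ℝ ∞ (firstSpeed g) := by
  have := (contDiff_infty_iff_deriv.1 hg).2
  unfold firstSpeed
  fun_prop (disch := exact fun m ↦ pow_ne_zero 2 (hg0 m))

lemma contDiff_secondSpeed (hg : ContDiff ℝ ∞ g) (hg0 : ∀ m, g m ≠ 0) :
    ContDiff ℝ ∞ (secondSpeed g) := by
  have := (contDiff_infty_iff_deriv.1 hg).2
  unfold secondSpeed
  fun_prop (disch := exact fun m ↦ pow_ne_zero 2 (hg0 m))

end ToricForms

section TorusFlow

variable {a b : ℝ → ℝ}

/-- The rotation of `ℂ²` by the angles `s` and `t` in the two coordinates. -/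
noncomputable def torusRotation (s t : ℝ) (x : EuclideanSpace ℝ (Fin 4)) :
    EuclideanSpace ℝ (Fin 4) :=
  !₂[Real.cos s * x 0 - Real.sin s * x 1, Real.sin s * x 0 + Real.cos s * x 1,
    Real.cos t * x 2 - Real.sin t * x 3, Real.sin t * x 2 + Real.cos t * x 3]

lemma torusRotation_zero (x : EuclideanSpace ℝ (Fin 4)) : torusRotation 0 0 x = x := by
  ext i; fin_cases i <;> simp [torusRotation]

lemma torusRotation_torusRotation (s t s' t' : ℝ) (x : EuclideanSpace ℝ (Fin 4)) :
    torusRotation s t (torusRotation s' t' x) = torusRotation (s + s') (t + t') x := by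
  ext i; fin_cases i <;> simp [torusRotation, Real.cos_add, Real.sin_add] <;> ring

lemma moment_torusRotation (s t : ℝ) (x : EuclideanSpace ℝ (Fin 4)) :
    moment (torusRotation s t x) = moment x := by
  simp only [moment, torusRotation, Matrix.cons_val]
  linear_combination (x 0 ^ 2 + x 1 ^ 2) * Real.sin_sq_add_cos_sq s -
    (x 2 ^ 2 + x 3 ^ 2) * Real.sin_sq_add_cos_sq t

lemma norm_torusRotation (s t : ℝ) (x : EuclideanSpace ℝ (Fin 4)) :
    ‖torusRotation s t x‖ = ‖x‖ := by
  refine (sq_eq_sq₀ (norm_nonneg _) (norm_nonneg _)).1 ?_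
  simp only [← real_inner_self_eq_norm_sq, real_inner_eq_sum_four, torusRotation, Matrix.cons_val]
  linear_combination (x 0 ^ 2 + x 1 ^ 2) * Real.sin_sq_add_cos_sq s +
    (x 2 ^ 2 + x 3 ^ 2) * Real.sin_sq_add_cos_sq t

lemma contDiff_torusRotation {n : WithTop ℕ∞} :
    ContDiff ℝ n fun p : (ℝ × ℝ) × EuclideanSpace ℝ (Fin 4) ↦ torusRotation p.1.1 p.1.2 p.2 := by
  refine contDiff_euclidean.2 fun i ↦ ?_
  fin_cases i <;> simp only [torusRotation, Fin.reduceFinMk, Fin.zero_eta, Fin.mk_one,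
    Matrix.cons_val] <;> fun_prop

lemma hasDerivAt_euclidean {n : ℕ} {f : ℝ → EuclideanSpace ℝ (Fin n)}
    {f' : EuclideanSpace ℝ (Fin n)} {t : ℝ} :
    HasDerivAt f f' t ↔ ∀ i, HasDerivAt (fun s ↦ f s i) (f' i) t := by
  simp only [hasDerivAt_iff_hasFDerivAt, ← hasFDerivWithinAt_univ, hasFDerivWithinAt_piLp]
  exact forall_congr' fun i ↦ iff_of_eq (by congr 1)

lemma hasDerivAt_torusRotation (a b t : ℝ) (x : EuclideanSpace ℝ (Fin 4)) :
    HasDerivAt (fun s ↦ torusRotation (s * a) (s * b) x)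
      (torusGenerator a b (torusRotation (t * a) (t * b) x)) t := by
  have hcos (c : ℝ) := (hasDerivAt_mul_const c (x := t)).cos
  have hsin (c : ℝ) := (hasDerivAt_mul_const c (x := t)).sin
  refine hasDerivAt_euclidean.2 fun i ↦ ?_
  fin_cases i <;> simp only [torusGenerator, torusRotation, Fin.reduceFinMk, Fin.zero_eta,
    Fin.mk_one, Matrix.cons_val]
  · exact (((hcos a).mul_const (x 0)).sub ((hsin a).mul_const (x 1))).congr_deriv (by ring)
  · exact (((hsin a).mul_const (x 0)).add ((hcos a).mul_const (x 1))).congr_deriv (by ring)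
  · exact (((hcos b).mul_const (x 2)).sub ((hsin b).mul_const (x 3))).congr_deriv (by ring)
  · exact (((hsin b).mul_const (x 2)).add ((hcos b).mul_const (x 3))).congr_deriv (by ring)

/-- The flow on the three-sphere of the vector field `torusField a b`. -/
noncomputable def torusFlow (ha : Continuous a) (hb : Continuous b) : Flow ℝ ThreeSphere where
  toFun t x := ⟨torusRotation (t * a (moment x)) (t * b (moment x)) x,
    mem_sphere_zero_iff_norm.2 ((norm_torusRotation _ _ _).trans (norm_eq_of_mem_sphere x))⟩
  cont' := by
    have hm : Continuous moment := (contDiff_moment (n := 0)).continuous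
    refine Continuous.subtype_mk ((contDiff_torusRotation (n := 0)).continuous.comp
      (f := fun p : ℝ × ThreeSphere ↦
        ((p.1 * a (moment p.2), p.1 * b (moment p.2)), (p.2 : EuclideanSpace ℝ (Fin 4)))) ?_) _
    fun_prop
  map_add' s t x := by
    simp only [moment_torusRotation, torusRotation_torusRotation, add_mul]
  map_zero' x := by
    simp only [zero_mul, torusRotation_zero]

variable {ha : Continuous a} {hb : Continuous b}

lemma coe_torusFlow (t : ℝ) (x : ThreeSphere) :
    (torusFlow ha hb t x : EuclideanSpace ℝ (Fin 4)) =
      torusRotation (t * a (moment x)) (t * b (moment x)) x := rfl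

lemma moment_torusFlow (t : ℝ) (x : ThreeSphere) :
    moment (torusFlow ha hb t x) = moment x := moment_torusRotation _ _ _

lemma isFlowOf_torusFlow : IsFlowOf (fun x ↦ torusField a b x) (torusFlow ha hb) :=
  fun x t ↦ by
    simp only [torusField, moment_torusFlow]
    exact hasDerivAt_torusRotation _ _ t x

lemma contMDiff_torusFlow {n : WithTop ℕ∞} (ha' : ContDiff ℝ n a) (hb' : ContDiff ℝ n b) :
    ContMDiff (𝓘(ℝ).prod (𝓡 3)) (𝓡 3) n fun z : ℝ × ThreeSphere ↦ torusFlow ha hb z.1 z.2 := by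
  have : Fact (Module.finrank ℝ (EuclideanSpace ℝ (Fin 4)) = 3 + 1) := ⟨by simp⟩
  have hm : ContDiff ℝ n moment := contDiff_moment
  have hmap : ContDiff ℝ n fun p : ℝ × EuclideanSpace ℝ (Fin 4) ↦
      torusRotation (p.1 * a (moment p.2)) (p.1 * b (moment p.2)) p.2 :=
    contDiff_torusRotation.comp (f := fun p : ℝ × EuclideanSpace ℝ (Fin 4) ↦
      ((p.1 * a (moment p.2), p.1 * b (moment p.2)), p.2)) (by fun_prop)
  have hpair : ContMDiff (𝓘(ℝ).prod (𝓡 3)) 𝓘(ℝ, ℝ × EuclideanSpace ℝ (Fin 4)) n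
      fun z : ℝ × ThreeSphere ↦ (z.1, z.2.1) :=
    contMDiff_fst.prodMk_space (contMDiff_coe_threeSphere.comp contMDiff_snd)
  exact (hmap.contMDiff.comp hpair).codRestrict_sphere fun z ↦ (torusFlow ha hb z.1 z.2).2

end TorusFlow

section Disks

/-- The point `(z, w)` of `ℂ² = ℝ⁴`. -/
noncomputable def complexPair (z w : ℂ) : EuclideanSpace ℝ (Fin 4) := !₂[z.re, z.im, w.re, w.im]

lemma norm_sq_complexPair (z w : ℂ) : ‖complexPair z w‖ ^ 2 = ‖z‖ ^ 2 + ‖w‖ ^ 2 := by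
  simp only [EuclideanSpace.norm_sq_eq, Fin.sum_univ_four, complexPair, Matrix.cons_val,
    Real.norm_eq_abs, sq_abs, Complex.sq_norm, Complex.normSq_apply]
  ring

lemma moment_complexPair (z w : ℂ) : moment (complexPair z w) = ‖z‖ ^ 2 - ‖w‖ ^ 2 := by
  simp only [moment, complexPair, Matrix.cons_val, Complex.sq_norm, Complex.normSq_apply]
  ring

lemma torusRotation_complexPair (s t : ℝ) (z w : ℂ) :
    torusRotation s t (complexPair z w) =
      complexPair (Complex.exp (s * Complex.I) * z) (Complex.exp (t * Complex.I) * w) := by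
  ext i
  fin_cases i <;>
    simp [torusRotation, complexPair, Complex.exp_ofReal_mul_I_re, Complex.exp_ofReal_mul_I_im] <;>
    ring

lemma continuous_complexPair : Continuous fun p : ℂ × ℂ ↦ complexPair p.1 p.2 := by
  refine (PiLp.continuous_toLp 2 _).comp (continuous_pi fun i ↦ ?_)
  fin_cases i <;> simp only [Fin.reduceFinMk, Fin.zero_eta, Fin.mk_one, Matrix.cons_val] <;>
    fun_prop

lemma norm_sq_sqrt_one_sub {c : ℝ} (hc : c ≤ 1) (w : closedBall (0 : ℂ) c) :
    ‖((√(1 - ‖(w : ℂ)‖ ^ 2) : ℝ) : ℂ)‖ ^ 2 = 1 - ‖(w : ℂ)‖ ^ 2 := by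
  have hw : ‖(w : ℂ)‖ ≤ 1 := (mem_closedBall_zero_iff.1 w.2).trans hc
  rw [Complex.norm_real, Real.norm_eq_abs, sq_abs, Real.sq_sqrt]
  exact sub_nonneg.2 (pow_le_one₀ (norm_nonneg _) hw)

/-- The disk in the three-sphere on which `z₁ ≥ 0` and `|z₂| ≤ c`, parametrized by `z₂`. -/
noncomputable def firstDisk {c : ℝ} (hc : c ≤ 1) : C(closedBall (0 : ℂ) c, ThreeSphere) where
  toFun w := ⟨complexPair (√(1 - ‖(w : ℂ)‖ ^ 2) : ℝ) w, by
    rw [mem_sphere_zero_iff_norm, ← pow_eq_one_iff_of_nonneg (norm_nonneg _) two_ne_zero,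
      norm_sq_complexPair, norm_sq_sqrt_one_sub hc, sub_add_cancel]⟩
  continuous_toFun := (continuous_complexPair.comp (by fun_prop :
    Continuous fun w : closedBall (0 : ℂ) c ↦
      (((√(1 - ‖(w : ℂ)‖ ^ 2) : ℝ) : ℂ), (w : ℂ)))).subtype_mk _

/-- The disk in the three-sphere on which `z₂ ≥ 0` and `|z₁| ≤ c`, parametrized by `z₁`. -/
noncomputable def secondDisk {c : ℝ} (hc : c ≤ 1) : C(closedBall (0 : ℂ) c, ThreeSphere) where
  toFun w := ⟨complexPair w (√(1 - ‖(w : ℂ)‖ ^ 2) : ℝ), by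
    rw [mem_sphere_zero_iff_norm, ← pow_eq_one_iff_of_nonneg (norm_nonneg _) two_ne_zero,
      norm_sq_complexPair, norm_sq_sqrt_one_sub hc, add_sub_cancel]⟩
  continuous_toFun := (continuous_complexPair.comp (by fun_prop :
    Continuous fun w : closedBall (0 : ℂ) c ↦
      ((w : ℂ), ((√(1 - ‖(w : ℂ)‖ ^ 2) : ℝ) : ℂ)))).subtype_mk _

variable {c : ℝ} (hc : c ≤ 1) (w : closedBall (0 : ℂ) c)

lemma coe_firstDisk :
    (firstDisk hc w : EuclideanSpace ℝ (Fin 4)) = complexPair (√(1 - ‖(w : ℂ)‖ ^ 2) : ℝ) w := rfl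

lemma coe_secondDisk :
    (secondDisk hc w : EuclideanSpace ℝ (Fin 4)) = complexPair w (√(1 - ‖(w : ℂ)‖ ^ 2) : ℝ) := rfl

lemma moment_firstDisk : moment (firstDisk hc w) = 1 - 2 * ‖(w : ℂ)‖ ^ 2 := by
  rw [coe_firstDisk, moment_complexPair, norm_sq_sqrt_one_sub hc]
  ring

lemma moment_secondDisk : moment (secondDisk hc w) = 2 * ‖(w : ℂ)‖ ^ 2 - 1 := by
  rw [coe_secondDisk, moment_complexPair, norm_sq_sqrt_one_sub hc]
  ring

lemma ofReal_mem_closedBall (hc0 : 0 ≤ c) : (c : ℂ) ∈ closedBall (0 : ℂ) c := by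
  simp [abs_of_nonneg hc0]

/-- The boundary circle of the disk of radius `c`, traversed once starting from `c`. -/
noncomputable def circleLoop (hc0 : 0 ≤ c) :
    Path (⟨c, ofReal_mem_closedBall hc0⟩ : closedBall (0 : ℂ) c)
      ⟨c, ofReal_mem_closedBall hc0⟩ where
  toFun s := ⟨Complex.exp ((s * (2 * Real.pi) : ℝ) * Complex.I) * c, by
    rw [mem_closedBall_zero_iff, norm_mul, Complex.norm_exp_ofReal_mul_I, one_mul,
      ← mem_closedBall_zero_iff]
    exact ofReal_mem_closedBall hc0⟩
  continuous_toFun := by fun_prop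
  source' := by simp
  target' := by simp

lemma coe_circleLoop (hc0 : 0 ≤ c) (s : unitInterval) : (circleLoop hc0 s : ℂ) =
    Complex.exp ((s * (2 * Real.pi) : ℝ) * Complex.I) * c := rfl

lemma norm_circleLoop (hc0 : 0 ≤ c) (s : unitInterval) : ‖(circleLoop hc0 s : ℂ)‖ = ‖(c : ℂ)‖ := by
  rw [coe_circleLoop, norm_mul, Complex.norm_exp_ofReal_mul_I, one_mul]

variable {a b : ℝ → ℝ} {ha : Continuous a} {hb : Continuous b} {m T : ℝ}

lemma firstDisk_circleLoop (hc0 : 0 ≤ c) (hm : 1 - 2 * c ^ 2 = m) (ham : a m = 0)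
    (hT : T * b m = 2 * Real.pi) (s : unitInterval) :
    firstDisk hc (circleLoop hc0 s) =
      torusFlow ha hb (s * T) (firstDisk hc ⟨c, ofReal_mem_closedBall hc0⟩) := by
  have hmoment : moment (firstDisk hc ⟨c, ofReal_mem_closedBall hc0⟩) = m := by
    rw [moment_firstDisk, Complex.norm_real, Real.norm_eq_abs, sq_abs, hm]
  refine Subtype.ext ?_
  rw [coe_torusFlow, hmoment, coe_firstDisk, coe_firstDisk, norm_circleLoop, coe_circleLoop,
    torusRotation_complexPair, ham, mul_zero, mul_assoc _ T, hT, Complex.ofReal_zero, zero_mul,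
    Complex.exp_zero, one_mul]

lemma secondDisk_circleLoop (hc0 : 0 ≤ c) (hm : 2 * c ^ 2 - 1 = m) (hbm : b m = 0)
    (hT : T * a m = 2 * Real.pi) (s : unitInterval) :
    secondDisk hc (circleLoop hc0 s) =
      torusFlow ha hb (s * T) (secondDisk hc ⟨c, ofReal_mem_closedBall hc0⟩) := by
  have hmoment : moment (secondDisk hc ⟨c, ofReal_mem_closedBall hc0⟩) = m := by
    rw [moment_secondDisk, Complex.norm_real, Real.norm_eq_abs, sq_abs, hm]
  refine Subtype.ext ?_
  rw [coe_torusFlow, hmoment, coe_secondDisk, coe_secondDisk, norm_circleLoop, coe_circleLoop,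
    torusRotation_complexPair, hbm, mul_assoc _ T, hT, mul_zero, Complex.ofReal_zero, zero_mul,
    Complex.exp_zero, one_mul]

lemma simplyConnectedSpace_closedBall (hc0 : 0 ≤ c) :
    SimplyConnectedSpace (closedBall (0 : ℂ) c) :=
  have := (convex_closedBall (0 : ℂ) c).contractibleSpace ⟨0, mem_closedBall_self hc0⟩
  inferInstance

end Disks

section TorusSections

variable {a b : ℝ → ℝ}

lemma exists_moment_eq {m : ℝ} (hm : -1 ≤ m) (hm' : m ≤ 1) :
    ∃ x : ThreeSphere, moment x = m := by
  have hc : √((1 - m) / 2) ≤ 1 := Real.sqrt_le_one.2 (by linarith)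
  refine ⟨firstDisk hc ⟨_, ofReal_mem_closedBall (Real.sqrt_nonneg _)⟩, ?_⟩
  rw [moment_firstDisk, Complex.norm_real, Real.norm_eq_abs, sq_abs, Real.sq_sqrt (by linarith)]
  ring

lemma speeds_not_both_zero (hne : ∀ x : ThreeSphere, torusField a b x ≠ 0) {m : ℝ} (hm : -1 ≤ m)
    (hm' : m ≤ 1) : ¬ (a m = 0 ∧ b m = 0) := by
  rintro ⟨ham, hbm⟩
  obtain ⟨x, rfl⟩ := exists_moment_eq hm hm'
  refine hne x ?_
  rw [torusField, ham, hbm]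
  ext i; fin_cases i <;> simp [torusGenerator]

theorem IsGlobalSurfaceOfSection.not_hasOneBoundaryComponent_of_torusFlow
    {M : Type} [TopologicalSpace M] [ChartedSpace (EuclideanHalfSpace 2) M]
    [IsManifold (𝓡∂ 2) ∞ M] [CompactSpace M] [ConnectedSpace M] {f : M → ThreeSphere}
    (ha : ContDiff ℝ ∞ a) (hb : ContDiff ℝ ∞ b)
    (h : IsGlobalSurfaceOfSection (fun x ↦ torusField a b x)
      (torusFlow ha.continuous hb.continuous) M f)
    (hne : ∀ x : ThreeSphere, torusField a b x ≠ 0) {m₁ m₂ : ℝ} (ham : a m₁ = 0) (hbm : b m₂ = 0)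
    (hm₂ : -1 ≤ m₂) (hm : m₂ < m₁) (hm₁ : m₁ ≤ 1) : ¬ HasOneBoundaryComponent M := by
  have hb₁ : b m₁ ≠ 0 := fun h ↦ speeds_not_both_zero hne (hm₂.trans hm.le) hm₁ ⟨ham, h⟩
  have ha₂ : a m₂ ≠ 0 := fun h ↦ speeds_not_both_zero hne hm₂ (hm.le.trans hm₁) ⟨h, hbm⟩
  set c₁ := √((1 - m₁) / 2) with hc₁
  set c₂ := √((1 + m₂) / 2) with hc₂
  have hc₁_sq : 1 - 2 * c₁ ^ 2 = m₁ := by rw [hc₁, Real.sq_sqrt (by linarith)]; ring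
  have hc₂_sq : 2 * c₂ ^ 2 - 1 = m₂ := by rw [hc₂, Real.sq_sqrt (by linarith)]; ring
  have hc₁0 : 0 ≤ c₁ := Real.sqrt_nonneg _
  have hc₂0 : 0 ≤ c₂ := Real.sqrt_nonneg _
  have hc₁1 : c₁ ≤ 1 := Real.sqrt_le_one.2 (by linarith)
  have hc₂1 : c₂ ≤ 1 := Real.sqrt_le_one.2 (by linarith)
  have := simplyConnectedSpace_closedBall hc₁0
  have := simplyConnectedSpace_closedBall hc₂0
  refine h.not_hasOneBoundaryComponent isFlowOf_torusFlow (contMDiff_torusFlow ha hb) hne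
    (m := fun x ↦ moment x) moment_torusFlow (firstDisk hc₁1) (secondDisk hc₂1)
    (circleLoop hc₁0) (circleLoop hc₂0) (div_ne_zero Real.two_pi_pos.ne' hb₁)
    (div_ne_zero Real.two_pi_pos.ne' ha₂)
    (firstDisk_circleLoop hc₁1 hc₁0 hc₁_sq ham (div_mul_cancel₀ _ hb₁))
    (secondDisk_circleLoop hc₂1 hc₂0 hc₂_sq hbm (div_mul_cancel₀ _ ha₂)) fun z₁ z₂ ↦ ?_
  have hz₁ := pow_le_pow_left₀ (norm_nonneg _) (mem_closedBall_zero_iff.1 z₁.2) 2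
  have hz₂ := pow_le_pow_left₀ (norm_nonneg _) (mem_closedBall_zero_iff.1 z₂.2) 2
  rw [moment_firstDisk, moment_secondDisk]
  linarith

lemma IsReebVectorField.ne_zero
    {α : EuclideanSpace ℝ (Fin 4) → EuclideanSpace ℝ (Fin 4) [⋀^Fin 1]→L[ℝ] ℝ}
    {R : ThreeSphere → EuclideanSpace ℝ (Fin 4)} (hR : IsReebVectorField α R) (x : ThreeSphere) :
    R x ≠ 0 := fun h ↦
  zero_ne_one (((α x).map_coord_zero (m := ![R x]) 0 h).symm.trans (hR.normalized x))

end TorusSections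

theorem mainTheorem1 :
    ∃ (α : EuclideanSpace ℝ (Fin 4) → EuclideanSpace ℝ (Fin 4) [⋀^Fin 1]→L[ℝ] ℝ)
      (R : ThreeSphere → EuclideanSpace ℝ (Fin 4)) (φ : Flow ℝ ThreeSphere),
      IsContactFormOnSphere α ∧
      (∀ x : ThreeSphere, {v | v ∈ tangentPlane x ∧ α x ![v] = 0} = standardContactPlane x) ∧
      IsReebVectorField α R ∧
      IsFlowOf R φ ∧
      (∀ (M : Type) [TopologicalSpace M] [ChartedSpace (EuclideanHalfSpace 2) M]
        [IsManifold (𝓡∂ 2) ∞ M] [CompactSpace M] [ConnectedSpace M] (f : M → ThreeSphere),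
        IsGlobalSurfaceOfSection R φ M f → ¬ HasOneBoundaryComponent M) ∧
      (∀ (M : Type) [TopologicalSpace M] [ChartedSpace (EuclideanHalfSpace 2) M]
        [IsManifold (𝓡∂ 2) ∞ M] [CompactSpace M] [ConnectedSpace M] (f : M → ThreeSphere),
        IsGlobalSurfaceOfSection R φ M f → ¬ IsDiskLike M) := by
  set g : ℝ → ℝ := fun m ↦ 1 + 3 * m ^ 2
  have hg : ContDiff ℝ ∞ g := by fun_prop
  have hg0 : ∀ m, g m ≠ 0 := fun m ↦ by positivity
  have hg' : ∀ m, deriv g m = 6 * m := fun m ↦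
    (((hasDerivAt_pow 2 m).const_mul 3).const_add 1).deriv.trans (by norm_num; ring)
  have hReeb := isReebVectorField_toricForm (hg.differentiable (by simp)) hg0
  have ha := contDiff_firstSpeed hg hg0
  have hb := contDiff_secondSpeed hg hg0
  have hsection (M : Type) [TopologicalSpace M] [ChartedSpace (EuclideanHalfSpace 2) M]
      [IsManifold (𝓡∂ 2) ∞ M] [CompactSpace M] [ConnectedSpace M] (f : M → ThreeSphere)
      (h : IsGlobalSurfaceOfSection (fun x ↦ torusField (firstSpeed g) (secondSpeed g) x)
        (torusFlow ha.continuous hb.continuous) M f) : ¬ HasOneBoundaryComponent M :=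
    h.not_hasOneBoundaryComponent_of_torusFlow ha hb hReeb.ne_zero (m₁ := 1 / 3) (m₂ := -1 / 3)
      (by norm_num [firstSpeed, hg', g]) (by norm_num [secondSpeed, hg', g])
      (by norm_num) (by norm_num) (by norm_num)
  refine ⟨toricForm g, _, torusFlow ha.continuous hb.continuous,
    isContactFormOnSphere_conformalForm (hg.comp contDiff_moment) fun x ↦ hg0 _,
    fun x ↦ ker_conformalForm (hg0 _), hReeb, isFlowOf_torusFlow, hsection,
    fun M _ _ _ _ _ f h hdisk ↦ ?_⟩
  have : T2Space M := h.embedding.isEmbedding.t2Space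
  exact hsection M f h hdisk.hasOneBoundaryComponent
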